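/- Let $n\ge 1$ and $\delta\ge 0$. For Schwartz functions $f,g$ on $\mathbb R^n$ put $$S^{\delta}(f,g)(x)=\iint_{|\xi|^2+|\eta|^2\le 1}e^{2\pi i x\cdot(\xi+\eta)}\,(1-|\xi|^2-|\eta|^2)^{\delta}\,\widehat f(\xi)\,\widehat g(\eta)\,d\xi\,d\eta,\qquad \widehat f(\xi)=\int_{\mathbb R^n}e^{-2\pi i x\cdot \xi}f(x)\,dx,$$ and call $S^\delta$ bounded from $L^{p_1}(\mathbb R^n)\times L^{p_2}(\mathbb R^n)$ into $L^p(\mathbb R^n)$ if there is a constant $C$ such that $\|S^\delta(f,g)\|_p\le C\|f\|_{p_1}\|g\|_{p_2}$ for all Schwartz functions $f,g$; otherwise it is called unbounded. Let $1\le p_1,p_2\le\infty$ and $1/p=1/p_1+1/p_2$ (with $1/\infty=0$), so that $0<p\le\infty$. (i) If $\delta>n-\tfrac12$, then $S^\delta$ is bounded from $L^{p_1}(\mathbb R^n)\times L^{p_2}(\mathbb R^n)$ into $L^p(\mathbb R^n)$. Moreover, with the kernel $K_\delta(y,z)=\iint_{|\xi|^2+|\eta|^2\le 1}e^{2\pi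 i (y\cdot\xi+z\cdot\eta)}(1-|\xi|^2-|\eta|^2)^\delta\,d\xi\,d\eta$, the formula $S^\delta(f,g)(x)=\iint K_\delta(x-y,x-z)f(y)g(z)\,dy\,dz$ holds for all $x$ when $f,g$ are integrable ($S^\delta(f,g)$ being given by the same Fourier integral), and for all $f\in L^{p_1}(\mathbb R^n)$, $g\in L^{p_2}(\mathbb R^n)$ its right-hand side converges absolutely for almost every $x$ and defines a function in $L^p(\mathbb R^n)$ whose $L^p$ (quasi-)norm is at most $C\|f\|_{p_1}\|g\|_{p_2}$, with $C$ independent of $f$ and $g$. (ii) If $\delta\le n\big(\tfrac1p-1\big)-\tfrac12$, equivalently $p\le \frac{2n}{2n+2\delta+1}$, then $S^\delta$ is not bounded from $L^{p_1}(\mathbb R^n)\times L^{p_2}(\mathbb R^n)$ into $L^p(\mathbb R^n)$. (iii) For every $1\le p\le\infty$ (here $p$ is no longer tied to $p_1,p_2$) with conjugate exponent $p'$, $1/p+1/p'=1$: if $\delta\le n\big|\tfrac1p-\tfrac12\big|-\tfrac12$, then $S^\delta$ is unbounded from $L^p(\mathbb R^n)\times L^\infty(\mathbb R^n)$ into $L^p(\mathbb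 R^n)$, from $L^\infty(\mathbb R^n)\times L^p(\mathbb R^n)$ into $L^p(\mathbb R^n)$, and from $L^p(\mathbb R^n)\times L^{p'}(\mathbb R^n)$ into $L^1(\mathbb R^n)$. -/

import Mathlib

open MeasureTheory
open scoped FourierTransform SchwartzMap NNReal ENNReal

noncomputable section

namespace BilinearBochnerRiesz

/-- Euclidean space `ℝⁿ`. -/
abbrev Eucl (n : ℕ) : Type := EuclideanSpace ℝ (Fin n)

/-- The set `|ξ|² + |η|² ≤ 1`, i.e. the closed Euclidean unit ball of `ℝⁿ × ℝⁿ = ℝ²ⁿ`. -/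
def unitBall (n : ℕ) : Set (Eucl n × Eucl n) :=
  {ζ | ‖ζ.1‖ ^ 2 + ‖ζ.2‖ ^ 2 ≤ 1}

/-- The bilinear Bochner-Riesz means of order `δ`,
`S^δ(f,g)(x) = ∬_{|ξ|²+|η|² ≤ 1} e^{2πi x·(ξ+η)} (1-|ξ|²-|η|²)^δ f̂(ξ) ĝ(η) dξ dη`,
where `f̂(ξ) = ∫ e^{-2πi x·ξ} f(x) dx`. -/
def bochnerRiesz {n : ℕ} (δ : ℝ) (f g : Eucl n → ℂ) (x : Eucl n) : ℂ :=
  ∫ ζ : Eucl n × Eucl n in unitBall n,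
    Complex.exp (2 * Real.pi * Complex.I * (inner ℝ x (ζ.1 + ζ.2) : ℝ)) *
      ((1 - ‖ζ.1‖ ^ 2 - ‖ζ.2‖ ^ 2) ^ δ : ℝ) * 𝓕 f ζ.1 * 𝓕 g ζ.2

/-- `S^δ`, initially defined on pairs of Schwartz functions, is bounded from `L^{p₁} × L^{p₂}`
into `L^p`: the estimate `‖S^δ(f,g)‖_p ≤ C ‖f‖_{p₁} ‖g‖_{p₂}` holds for all Schwartz functions
`f`, `g` with a constant `C` independent of them. In particular, if this fails then `S^δ` has no
bounded extension to `L^{p₁} × L^{p₂}`. -/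
def IsBoundedOnSchwartz (n : ℕ) (δ : ℝ) (p₁ p₂ p : ℝ≥0∞) : Prop :=
  ∃ C : ℝ≥0, ∀ f g : 𝓢(Eucl n, ℂ),
    eLpNorm (bochnerRiesz δ f g) p volume ≤ C * eLpNorm f p₁ volume * eLpNorm g p₂ volume

/-- The kernel of `S^δ`: the inverse Fourier transform on `ℝ²ⁿ` of the symbol
`(1-|ξ|²-|η|²)₊^δ`. -/
def kernel {n : ℕ} (δ : ℝ) (w : Eucl n × Eucl n) : ℂ :=
  ∫ ζ : Eucl n × Eucl n in unitBall n,
    Complex.exp (2 * Real.pi * Complex.I * (inner ℝ w.1 ζ.1 + inner ℝ w.2 ζ.2 : ℝ)) *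
      ((1 - ‖ζ.1‖ ^ 2 - ‖ζ.2‖ ^ 2) ^ δ : ℝ)

/-- The integrand of the kernel representation of `S^δ(f,g)(x)`. -/
def kernelIntegrand {n : ℕ} (δ : ℝ) (f g : Eucl n → ℂ) (x : Eucl n) (w : Eucl n × Eucl n) : ℂ :=
  kernel δ (x - w.1, x - w.2) * f w.1 * g w.2

/-- The kernel representation `∬ K(x-y, x-z) f(y) g(z) dy dz` of `S^δ(f,g)(x)`. -/
def kernelOp {n : ℕ} (δ : ℝ) (f g : Eucl n → ℂ) (x : Eucl n) : ℂ :=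
  ∫ w : Eucl n × Eucl n, kernelIntegrand δ f g x w

/-- The kernel representation extends `S^δ` to a bounded operator on the whole of
`L^{p₁} × L^{p₂}` with values in `L^p`: it coincides with `S^δ` on integrable functions (so on
Schwartz functions), and for all `f ∈ L^{p₁}`, `g ∈ L^{p₂}` the integral converges absolutely for
almost every `x` and defines a function in `L^p` of norm at most `C ‖f‖_{p₁} ‖g‖_{p₂}`. -/
def HasBoundedKernelExtension (n : ℕ) (δ : ℝ) (p₁ p₂ p : ℝ≥0∞) : Prop :=
  (∀ f g : Eucl n → ℂ, Integrable f volume → Integrable g volume →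
    ∀ x, kernelOp δ f g x = bochnerRiesz δ f g x) ∧
  ∃ C : ℝ≥0, ∀ f g : Eucl n → ℂ, MemLp f p₁ volume → MemLp g p₂ volume →
    (∀ᵐ x, Integrable (kernelIntegrand δ f g x) volume) ∧
    MemLp (kernelOp δ f g) p volume ∧
    eLpNorm (kernelOp δ f g) p volume ≤ C * eLpNorm f p₁ volume * eLpNorm g p₂ volume

end BilinearBochnerRiesz

end

/-!
The kernel of `S^δ` on `ℝ²ⁿ` and the kernels of the linear Bochner-Riesz multipliers on `ℝⁿ` are
radial and reduce to Poisson integrals of Bessel type. Shifting the contour into the upper half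
plane writes such an integral of index `μ` as `2 s^{-(μ+1)} Im (e^{is} A(s))`, where `A` has a
nonzero limit at infinity. In dimension `d` this bounds the kernel by a multiple of
`(1 + |x|)^{-(δ + (d+1)/2)}`. Since `Im (e^{is} A(s))` and its shift by a quarter period cannot both
be small, it also shows that the restriction of the kernel to a scaled `d'`-dimensional subspace is
not in `L^p` when `p (δ + (d+1)/2) ≤ d'`.

(i) For `δ > n - 1/2` the upper bound on `ℝ²ⁿ` splits into a product of an integrable function of
`y` and an integrable function of `z`, so that Young's and Hölder's inequalities apply.

(ii) If `f̂ = ĝ = 1` on the unit ball, then `S^δ(f, g)(x) = K(x, x)` is the kernel on `ℝ²ⁿ`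
restricted to the diagonal, which is not in `L^p`.

(iii) Pairing `S^δ(f, g)` with a third function gives a trilinear form whose frequencies sum to
zero. Concentrating one of the `L^∞` functions at frequency `0` leaves the bilinear form of the
multiplier `(1 - |ξ|²)₊^δ` or `(1 - 2|ξ|²)₊^δ`, according to which function is frozen. If that form
were bounded on `L^p × L^{p'}`, then its kernel would lie in `L^{min(p, p')}` by the converse of
Hölder's inequality.
-/

noncomputable section

namespace BilinearBochnerRiesz

open Set Filter Topology
open Complex (I)
open scoped ComplexConjugate Real

/-- The truncated power `(1 - t)₊^δ`. It vanishes for `t > 1` also when `δ = 0`, where `0 ^ δ = 1`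
would give the constant symbol `1`. -/
def rieszSymbol (δ t : ℝ) : ℝ := if t ≤ 1 then (1 - t) ^ δ else 0

section RieszSymbol

variable {δ t : ℝ}

lemma rieszSymbol_of_le (ht : t ≤ 1) : rieszSymbol δ t = (1 - t) ^ δ := if_pos ht

lemma rieszSymbol_of_lt (ht : 1 < t) : rieszSymbol δ t = 0 := if_neg ht.not_ge

lemma rieszSymbol_nonneg (δ t : ℝ) : 0 ≤ rieszSymbol δ t := by
  unfold rieszSymbol
  split_ifs with h
  · exact Real.rpow_nonneg (sub_nonneg.2 h) _
  · exact le_rfl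

lemma rieszSymbol_le_one (hδ : 0 ≤ δ) (ht : 0 ≤ t) : rieszSymbol δ t ≤ 1 := by
  unfold rieszSymbol
  split_ifs with h
  · exact Real.rpow_le_one (sub_nonneg.2 h) (sub_le_self 1 ht) hδ
  · exact zero_le_one

@[fun_prop]
lemma measurable_rieszSymbol (δ : ℝ) : Measurable (rieszSymbol δ) :=
  Measurable.ite measurableSet_Iic (by fun_prop) measurable_const

lemma continuousAt_rieszSymbol (ht : t ≠ 1) : ContinuousAt (rieszSymbol δ) t := by
  rcases ht.lt_or_gt with h | h
  · have hpow : ContinuousAt (fun u : ℝ => (1 - u) ^ δ) t :=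
      ContinuousAt.rpow_const (by fun_prop) (Or.inl (sub_ne_zero.2 ht.symm))
    refine hpow.congr ?_
    filter_upwards [Iio_mem_nhds h] with u hu using (rieszSymbol_of_le (le_of_lt hu)).symm
  · refine (continuousAt_const (y := (0 : ℝ))).congr ?_
    filter_upwards [Ioi_mem_nhds h] with u hu using (rieszSymbol_of_lt hu).symm

end RieszSymbol

/-! ### The Bessel integral -/

section ExpMulRpow

lemma tendsto_exp_neg_mul_add_rpow (a ν : ℝ) {s : ℝ} (hs : 0 < s) :
    Tendsto (fun y : ℝ => Real.exp (-s * y) * (a + y) ^ ν) atTop (𝓝 0) := by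
  have h := ((tendsto_rpow_mul_exp_neg_mul_atTop_nhds_zero ν s hs).comp
    (tendsto_atTop_add_const_left atTop a tendsto_id)).mul_const (Real.exp (s * a))
  rw [zero_mul] at h
  refine h.congr fun y => ?_
  simp only [Function.comp, id]
  rw [mul_assoc, ← Real.exp_add, mul_comm]
  ring_nf

lemma integrableOn_exp_neg_mul_add_rpow {a : ℝ} (ha : 0 < a) (ν : ℝ) {s : ℝ} (hs : 0 < s) :
    IntegrableOn (fun y : ℝ => Real.exp (-s * y) * (a + y) ^ ν) (Ioi 0) := by
  refine integrable_of_isBigO_exp_neg (b := s / 2) (by positivity) (fun y hy => ?_) ?_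
  · have hay : a + y ≠ 0 := (add_pos_of_pos_of_nonneg ha hy).ne'
    exact ((by fun_prop : ContinuousAt (fun y : ℝ => Real.exp (-s * y)) y).mul
      (ContinuousAt.rpow_const (by fun_prop) (Or.inl hay))).continuousWithinAt
  · have h := ((tendsto_exp_neg_mul_add_rpow a ν (half_pos hs)).isBigO_one ℝ).mul
      (Asymptotics.isBigO_refl (fun y : ℝ => Real.exp (-(s / 2) * y)) atTop)
    refine (h.congr_left fun y => ?_).congr_right fun y => one_mul _
    rw [mul_right_comm, ← Real.exp_add]
    ring_nf

end ExpMulRpow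

section ComplexPower

variable {μ : ℝ}

lemma ofReal_mul_cpow {r : ℝ} (hr : 0 < r) {z : ℂ} (hz : z ≠ 0) (w : ℂ) :
    ((r : ℂ) * z) ^ w = (r : ℂ) ^ w * z ^ w := by
  have hr' : (r : ℂ) ≠ 0 := by exact_mod_cast hr.ne'
  rw [Complex.cpow_def_of_ne_zero (mul_ne_zero hr' hz), Complex.log_ofReal_mul hr hz, add_mul,
    Complex.exp_add, Complex.cpow_def_of_ne_zero hz, Complex.cpow_def_of_ne_zero hr',
    Complex.ofReal_log hr.le]

lemma continuousAt_cpow_of_re_nonneg (hμ : 0 ≤ μ) {z : ℂ} (hz : 0 ≤ z.re) :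
    ContinuousAt (fun z : ℂ => z ^ (μ : ℂ)) z := by
  rcases hμ.eq_or_lt with rfl | h
  · simpa using continuousAt_const
  · exact Complex.continuousAt_cpow_const_of_re_pos (Or.inl hz) (by simpa using h)

lemma conj_cpow_ofReal_of_re_nonneg {z : ℂ} (hz : 0 ≤ z.re) (μ : ℝ) :
    conj (z ^ (μ : ℂ)) = conj z ^ (μ : ℂ) := by
  rw [Complex.conj_cpow _ _ fun h => (Complex.arg_eq_pi_iff.1 h).1.not_ge hz, Complex.conj_ofReal]

lemma norm_neg_I_cpow_ofReal (μ : ℝ) : ‖(-I) ^ (μ : ℂ)‖ = 1 := by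
  rw [Complex.norm_cpow_real, norm_neg, Complex.norm_I, Real.one_rpow]

end ComplexPower

/-- Poisson's integral `∫_{-1}^{1} e^{ist} (1-t²)^μ dt`, which is `s^{-ν} J_ν(s)` with `ν = μ + 1/2`
up to a constant factor. -/
def besselIntegral (μ s : ℝ) : ℂ :=
  ∫ t : ℝ in (-1)..1, Complex.exp (I * s * t) * ((1 - t ^ 2) ^ μ : ℝ)

/-- The continuation of `e^{ist} (1-t²)^μ` to `|Re z| ≤ 1`, holomorphic in the open strip. The
factors `1 - z` and `1 + z` are kept apart, so that each has non-negative real part and the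
principal branch can be used. -/
def besselExt (μ s : ℝ) (z : ℂ) : ℂ :=
  Complex.exp (I * s * z) * (1 - z) ^ (μ : ℂ) * (1 + z) ^ (μ : ℂ)

/-- The slowly varying amplitude in the oscillatory representation
`besselIntegral μ s = 2 s^{-(μ+1)} Im (e^{is} besselAmp μ s)`. -/
def besselAmp (μ s : ℝ) : ℂ :=
  (-I) ^ (μ : ℂ) *
    ∫ v : ℝ in Ioi 0, ((Real.exp (-v) * v ^ μ : ℝ) : ℂ) * (2 + (v / s : ℝ) * I) ^ (μ : ℂ)

section Bessel

variable {μ s x : ℝ}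

lemma besselIntegral_eq_integral_rieszSymbol (μ s : ℝ) :
    besselIntegral μ s =
      ∫ t : ℝ, Complex.exp (I * s * t) * (rieszSymbol μ (t ^ 2) : ℝ) := by
  rw [besselIntegral, intervalIntegral.integral_of_le (by norm_num),
    ← integral_Icc_eq_integral_Ioc, ← integral_indicator measurableSet_Icc]
  refine integral_congr_ae (Eventually.of_forall fun t => ?_)
  by_cases ht : t ∈ Icc (-1 : ℝ) 1
  · simp only [indicator_of_mem ht, rieszSymbol_of_le (show t ^ 2 ≤ 1 by nlinarith [ht.1, ht.2])]
  · have ht' : 1 < t ^ 2 := by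
      by_contra! h
      exact ht (abs_le.1 (sq_le_one_iff_abs_le_one t |>.1 h))
    simp only [indicator_of_notMem ht, rieszSymbol_of_lt ht', Complex.ofReal_zero, mul_zero]

lemma continuousAt_besselExt (hμ : 0 ≤ μ) (s : ℝ) {z : ℂ} (hz : z.re ∈ Icc (-1 : ℝ) 1) :
    ContinuousAt (besselExt μ s) z := by
  refine ((by fun_prop : ContinuousAt (fun z => Complex.exp (I * s * z)) z).mul ?_).mul ?_
  · exact ContinuousAt.comp (f := fun z : ℂ => 1 - z) (g := fun z : ℂ => z ^ (μ : ℂ))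
      (continuousAt_cpow_of_re_nonneg hμ (by simpa using hz.2)) (by fun_prop)
  · exact ContinuousAt.comp (f := fun z : ℂ => 1 + z) (g := fun z : ℂ => z ^ (μ : ℂ))
      (continuousAt_cpow_of_re_nonneg hμ (by simpa using neg_le_iff_add_nonneg'.1 hz.1))
      (by fun_prop)

lemma differentiableAt_besselExt (μ s : ℝ) {z : ℂ} (hz : z.re ∈ Ioo (-1 : ℝ) 1) :
    DifferentiableAt ℂ (besselExt μ s) z := by
  refine ((by fun_prop : DifferentiableAt ℂ (fun z => Complex.exp (I * s * z)) z).mul ?_).mul ?_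
  · exact (by fun_prop : DifferentiableAt ℂ (fun z : ℂ => 1 - z) z).cpow_const
      (Or.inl (by simpa using hz.2))
  · exact (by fun_prop : DifferentiableAt ℂ (fun z : ℂ => 1 + z) z).cpow_const
      (Or.inl (by simpa using neg_lt_iff_pos_add'.1 hz.1))

lemma besselExt_ofReal (μ s : ℝ) {t : ℝ} (ht : t ∈ Icc (-1 : ℝ) 1) :
    besselExt μ s t = Complex.exp (I * s * t) * ((1 - t ^ 2) ^ μ : ℝ) := by
  have h1 : 0 ≤ 1 - t := by linarith [ht.2]
  have h2 : 0 ≤ 1 + t := by linarith [ht.1]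
  rw [besselExt, show (1 : ℝ) - t ^ 2 = (1 - t) * (1 + t) by ring, Real.mul_rpow h1 h2,
    Complex.ofReal_mul, Complex.ofReal_cpow h1, Complex.ofReal_cpow h2]
  push_cast
  ring

lemma besselExt_neg_conj (μ s : ℝ) {z : ℂ} (hz : z.re ∈ Icc (-1 : ℝ) 1) :
    besselExt μ s (-conj z) = conj (besselExt μ s z) := by
  have hexp : I * s * (-conj z) = conj (I * s * z) := by simp
  have hminus : (1 : ℂ) + -conj z = conj (1 - z) := by simp [sub_eq_add_neg]
  have hplus : (1 : ℂ) - -conj z = conj (1 + z) := by simp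
  rw [besselExt, besselExt, map_mul, map_mul,
    conj_cpow_ofReal_of_re_nonneg (z := 1 - z) (by simpa using hz.2),
    conj_cpow_ofReal_of_re_nonneg (z := 1 + z) (by simpa using neg_le_iff_add_nonneg'.1 hz.1),
    ← Complex.exp_conj, hexp, hminus, hplus]
  ring

lemma norm_besselExt_le (hμ : 0 ≤ μ) (s : ℝ) (hx : x ∈ Icc (-1 : ℝ) 1) {y : ℝ} (hy : 0 ≤ y) :
    ‖besselExt μ s (x + y * I)‖ ≤ Real.exp (-s * y) * (2 + y) ^ (2 * μ) := by
  have hfactor : ∀ a : ℝ, |a| ≤ 2 → ∀ b : ℝ, |b| = y →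
      ‖((a : ℂ) + b * I) ^ (μ : ℂ)‖ ≤ (2 + y) ^ μ := by
    intro a ha b hb
    rw [Complex.norm_cpow_real]
    refine Real.rpow_le_rpow (norm_nonneg _) ((norm_add_le _ _).trans ?_) hμ
    simpa [hb] using ha
  have hminus : (1 : ℂ) - (x + y * I) = ((1 - x : ℝ) : ℂ) + ((-y : ℝ) : ℂ) * I := by
    push_cast; ring
  have hplus : (1 : ℂ) + (x + y * I) = ((1 + x : ℝ) : ℂ) + (y : ℂ) * I := by
    push_cast; ring
  have hre : (I * s * (x + y * I)).re = -s * y := by simp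
  rw [besselExt, norm_mul, norm_mul, Complex.norm_exp, hminus, hplus, hre, mul_assoc, two_mul,
    Real.rpow_add (by linarith)]
  gcongr
  · exact hfactor _ (abs_le.2 ⟨by linarith [hx.2], by linarith [hx.1]⟩) _
      (by rw [abs_neg, abs_of_nonneg hy])
  · exact hfactor _ (abs_le.2 ⟨by linarith [hx.1], by linarith [hx.2]⟩) _ (abs_of_nonneg hy)

lemma integrableOn_besselExt_vertical (hμ : 0 ≤ μ) (hs : 0 < s) (hx : x ∈ Icc (-1 : ℝ) 1) :
    IntegrableOn (fun y : ℝ => besselExt μ s (x + y * I)) (Ioi 0) := by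
  have hcont : Continuous fun y : ℝ => besselExt μ s (x + y * I) :=
    continuous_iff_continuousAt.2 fun y =>
      ContinuousAt.comp (f := fun y : ℝ => (x + y * I : ℂ)) (g := besselExt μ s)
        (continuousAt_besselExt hμ s (by simpa using hx)) (by fun_prop)
  refine (integrableOn_exp_neg_mul_add_rpow two_pos (2 * μ) hs).mono'
    hcont.aestronglyMeasurable ?_
  filter_upwards [ae_restrict_mem measurableSet_Ioi] with y hy
  exact norm_besselExt_le hμ s hx (le_of_lt hy)

lemma tendsto_integral_besselExt_horizontal (hμ : 0 ≤ μ) (hs : 0 < s) :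
    Tendsto (fun H : ℝ => ∫ x : ℝ in (-1)..1, besselExt μ s (x + H * I)) atTop (𝓝 0) := by
  have hbound := (tendsto_exp_neg_mul_add_rpow 2 (2 * μ) hs).mul_const |(1 : ℝ) - (-1)|
  rw [zero_mul] at hbound
  refine squeeze_zero_norm' ?_ hbound
  filter_upwards [eventually_ge_atTop 0] with H hH
  refine intervalIntegral.norm_integral_le_of_norm_le_const fun x hx => ?_
  rw [uIoc_of_le (by norm_num)] at hx
  exact norm_besselExt_le hμ s ⟨hx.1.le, hx.2⟩ hH

lemma besselIntegral_eq_rectangle (hμ : 0 ≤ μ) (s H : ℝ) :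
    besselIntegral μ s = (∫ x : ℝ in (-1)..1, besselExt μ s (x + H * I)) -
      I * (∫ y : ℝ in (0)..H, besselExt μ s ((1 : ℝ) + y * I)) +
      I * (∫ y : ℝ in (0)..H, besselExt μ s ((-1 : ℝ) + y * I)) := by
  have hbottom : besselIntegral μ s =
      ∫ x : ℝ in (-1)..1, besselExt μ s (x + (0 : ℝ) * I) := by
    refine intervalIntegral.integral_congr fun t ht => ?_
    rw [uIcc_of_le (by norm_num)] at ht
    simpa using (besselExt_ofReal μ s ht).symm
  have hcauchy := Complex.integral_boundary_rect_eq_zero_of_continuousOn_of_differentiableOn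
    (besselExt μ s) (-1) (1 + H * I)
    (fun z hz => (continuousAt_besselExt hμ s
      (by simpa [uIcc_of_le (show (-1 : ℝ) ≤ 1 by norm_num)] using hz.1)).continuousWithinAt)
    (fun z hz => (differentiableAt_besselExt μ s
      (by simpa using hz.1)).differentiableWithinAt)
  simp only [Complex.neg_re, Complex.one_re, Complex.add_re, Complex.mul_re, Complex.ofReal_re,
    Complex.I_re, Complex.ofReal_im, Complex.I_im, Complex.neg_im, Complex.one_im,
    Complex.add_im, Complex.mul_im, smul_eq_mul, mul_zero, mul_one, sub_zero, add_zero,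
    zero_add, neg_zero] at hcauchy
  rw [hbottom]
  linear_combination hcauchy

lemma besselIntegral_eq_im_vertical (hμ : 0 ≤ μ) (hs : 0 < s) :
    besselIntegral μ s =
      ((2 * (∫ y : ℝ in Ioi 0, besselExt μ s ((1 : ℝ) + y * I)).im : ℝ) : ℂ) := by
  have hvertical : ∀ x ∈ Icc (-1 : ℝ) 1,
      Tendsto (fun H => I * ∫ y : ℝ in (0)..H, besselExt μ s (x + y * I)) atTop
        (𝓝 (I * ∫ y : ℝ in Ioi 0, besselExt μ s (x + y * I))) := fun x hx =>
    (intervalIntegral_tendsto_integral_Ioi 0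
      (integrableOn_besselExt_vertical hμ hs hx) tendsto_id).const_mul I
  have hlim := ((tendsto_integral_besselExt_horizontal hμ hs).sub (hvertical 1 (by simp))).add
    (hvertical (-1) (by simp))
  have hsides := tendsto_nhds_unique
    (tendsto_const_nhds.congr (besselIntegral_eq_rectangle hμ s)) hlim
  have hconj : ∫ y : ℝ in Ioi 0, besselExt μ s ((-1 : ℝ) + y * I) =
      conj (∫ y : ℝ in Ioi 0, besselExt μ s ((1 : ℝ) + y * I)) := by
    rw [← integral_conj]
    congr 1 with y
    rw [← besselExt_neg_conj μ s (by simp)]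
    simp [add_comm]
  rw [hsides, hconj, zero_sub, neg_add_eq_sub, ← mul_sub, ← neg_sub, Complex.sub_conj]
  push_cast
  linear_combination (-2 * ((∫ y : ℝ in Ioi 0,
    besselExt μ s ((1 : ℝ) + y * I)).im : ℂ)) * Complex.I_sq

lemma integral_besselExt_one_add_mul_I (μ : ℝ) (hs : 0 < s) :
    ∫ y : ℝ in Ioi 0, besselExt μ s ((1 : ℝ) + y * I) =
      (s ^ (-(μ + 1)) : ℝ) * (Complex.exp (I * s) * besselAmp μ s) := by
  have hsubst := integral_comp_mul_left_Ioi (fun v : ℝ =>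
    ((Real.exp (-v) * v ^ μ : ℝ) : ℂ) * (2 + (v / s : ℝ) * I) ^ (μ : ℂ)) 0 hs
  rw [mul_zero, eq_inv_smul_iff₀ hs.ne', Complex.real_smul] at hsubst
  rw [besselAmp, ← hsubst]
  simp only [← integral_const_mul]
  refine setIntegral_congr_fun measurableSet_Ioi fun y hy => ?_
  have hy : 0 < y := hy
  have hminus : (1 : ℂ) - (((1 : ℝ) : ℂ) + y * I) = (y : ℂ) * (-I) := by push_cast; ring
  have hplus : (1 : ℂ) + (((1 : ℝ) : ℂ) + y * I) = 2 + y * I := by push_cast; ring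
  have hexp : Complex.exp (I * s * (((1 : ℝ) : ℂ) + y * I)) =
      Complex.exp (I * s) * (Real.exp (-(s * y)) : ℝ) := by
    rw [Complex.ofReal_exp, ← Complex.exp_add]
    congr 1
    push_cast
    linear_combination (s * y : ℂ) * Complex.I_sq
  have hpow : ((s ^ (-(μ + 1)) : ℝ) : ℂ) * s * ((s ^ μ : ℝ) : ℂ) = 1 := by
    norm_cast
    rw [Real.rpow_neg hs.le, Real.rpow_add hs, Real.rpow_one]
    field_simp
  rw [besselExt, hminus, hplus, hexp, ofReal_mul_cpow hy (by simp), ← Complex.ofReal_cpow hy.le,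
    mul_div_cancel_left₀ _ hs.ne', Real.mul_rpow hs.le hy.le, Complex.ofReal_mul,
    Complex.ofReal_mul]
  linear_combination (-Complex.exp (I * s) * (Real.exp (-(s * y)) : ℝ) *
    ((y ^ μ : ℝ) * (-I) ^ (μ : ℂ)) * (2 + y * I) ^ (μ : ℂ)) * hpow

lemma besselIntegral_eq_im_besselAmp (hμ : 0 ≤ μ) (hs : 0 < s) :
    besselIntegral μ s =
      ((2 * s ^ (-(μ + 1)) * (Complex.exp (I * s) * besselAmp μ s).im : ℝ) : ℂ) := by
  rw [besselIntegral_eq_im_vertical hμ hs, integral_besselExt_one_add_mul_I μ hs,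
    Complex.im_ofReal_mul, mul_assoc]

lemma norm_besselAmp_integrand_le (hμ : 0 ≤ μ) (hs : 1 ≤ s) {v : ℝ} (hv : 0 < v) :
    ‖((Real.exp (-v) * v ^ μ : ℝ) : ℂ) * (2 + (v / s : ℝ) * I) ^ (μ : ℂ)‖ ≤
      Real.exp (-1 * v) * (2 + v) ^ (2 * μ) := by
  have hbase : ‖(2 : ℂ) + (v / s : ℝ) * I‖ ≤ 2 + v := by
    refine (norm_add_le _ _).trans ?_
    rw [norm_mul, Complex.norm_real, Complex.norm_I, mul_one, Real.norm_of_nonneg (by positivity),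
      Complex.norm_ofNat]
    gcongr
    exact div_le_self hv.le hs
  rw [norm_mul, Complex.norm_real, Complex.norm_cpow_real, Real.norm_of_nonneg (by positivity),
    two_mul, Real.rpow_add (by linarith), neg_one_mul, mul_assoc]
  gcongr
  linarith

lemma exists_norm_besselAmp_le (hμ : 0 ≤ μ) :
    ∃ M : ℝ, ∀ s : ℝ, 1 ≤ s → ‖besselAmp μ s‖ ≤ M := by
  refine ⟨∫ v : ℝ in Ioi 0, Real.exp (-1 * v) * (2 + v) ^ (2 * μ), fun s hs => ?_⟩
  rw [besselAmp, norm_mul, norm_neg_I_cpow_ofReal, one_mul]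
  refine norm_integral_le_of_norm_le (integrableOn_exp_neg_mul_add_rpow two_pos _ one_pos) ?_
  filter_upwards [ae_restrict_mem measurableSet_Ioi] with v hv
  exact norm_besselAmp_integrand_le hμ hs hv

lemma tendsto_besselAmp (hμ : 0 ≤ μ) :
    Tendsto (besselAmp μ) atTop
      (𝓝 ((-I) ^ (μ : ℂ) * ((2 ^ μ * Real.Gamma (μ + 1) : ℝ) : ℂ))) := by
  have hGamma : ((2 ^ μ * Real.Gamma (μ + 1) : ℝ) : ℂ) =
      ∫ v : ℝ in Ioi 0, ((Real.exp (-v) * v ^ μ : ℝ) : ℂ) * ((2 : ℂ) ^ (μ : ℂ)) := by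
    rw [integral_mul_const, integral_complex_ofReal, Real.Gamma_eq_integral (by linarith),
      add_sub_cancel_right, Complex.ofReal_mul, Complex.ofReal_cpow zero_le_two, mul_comm,
      Complex.ofReal_ofNat]
  have hbase : ∀ v : ℝ, Tendsto (fun s : ℝ => (2 : ℂ) + (v / s : ℝ) * I) atTop (𝓝 2) := by
    intro v
    have hdiv : Tendsto (fun s : ℝ => ((v / s : ℝ) : ℂ)) atTop (𝓝 ((0 : ℝ) : ℂ)) :=
      (Complex.continuous_ofReal.tendsto 0).comp (tendsto_const_nhds.div_atTop tendsto_id)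
    simpa using (hdiv.mul_const I).const_add 2
  rw [hGamma]
  refine Tendsto.const_mul _ (tendsto_integral_filter_of_dominated_convergence
    (fun v => Real.exp (-1 * v) * (2 + v) ^ (2 * μ))
    (Eventually.of_forall fun s => Measurable.aestronglyMeasurable (by fun_prop)) ?_
    (integrableOn_exp_neg_mul_add_rpow two_pos _ one_pos) ?_)
  · filter_upwards [eventually_ge_atTop 1] with s hs
    filter_upwards [ae_restrict_mem measurableSet_Ioi] with v hv
    exact norm_besselAmp_integrand_le hμ hs hv
  · refine Eventually.of_forall fun v => Tendsto.const_mul _ ?_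
    exact (continuousAt_cpow_of_re_nonneg hμ (z := 2) (by norm_num)).tendsto.comp (hbase v)

lemma norm_besselIntegral_le_two (hμ : 0 ≤ μ) (s : ℝ) : ‖besselIntegral μ s‖ ≤ 2 := by
  have hbound : ∀ t ∈ uIoc (-1 : ℝ) 1,
      ‖Complex.exp (I * s * t) * ((1 - t ^ 2) ^ μ : ℝ)‖ ≤ 1 := by
    intro t ht
    rw [uIoc_of_le (by norm_num)] at ht
    have h1 : 0 ≤ 1 - t ^ 2 := by nlinarith [ht.1, ht.2]
    rw [norm_mul, Complex.norm_real, Real.norm_of_nonneg (Real.rpow_nonneg h1 _),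
      Complex.norm_exp]
    simpa using Real.rpow_le_one h1 (by nlinarith) hμ
  refine (intervalIntegral.norm_integral_le_of_norm_le_const hbound).trans ?_
  norm_num

lemma exists_norm_besselIntegral_le (hμ : 0 ≤ μ) :
    ∃ C : ℝ, 0 < C ∧ ∀ s : ℝ, 0 ≤ s → ‖besselIntegral μ s‖ ≤ C * (1 + s) ^ (-(μ + 1)) := by
  obtain ⟨M, hM⟩ := exists_norm_besselAmp_le hμ
  have hM0 : 0 ≤ M := (norm_nonneg _).trans (hM 1 le_rfl)
  refine ⟨(2 + 2 * M) * 2 ^ (μ + 1), by positivity, fun s hs => ?_⟩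
  have hhalf : ((1 + s) / 2) ^ (-(μ + 1)) = 2 ^ (μ + 1) * (1 + s) ^ (-(μ + 1)) := by
    rw [Real.div_rpow (by linarith) zero_le_two, Real.rpow_neg zero_le_two, div_inv_eq_mul,
      mul_comm]
  have hpos : 0 < (1 + s) / 2 := by linarith
  rw [mul_assoc, ← hhalf]
  rcases le_total s 1 with h | h
  · have hone : 1 ≤ ((1 + s) / 2) ^ (-(μ + 1)) :=
      Real.one_le_rpow_of_pos_of_le_one_of_nonpos hpos (by linarith) (by linarith)
    nlinarith [norm_besselIntegral_le_two hμ s]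
  · have hosc : ‖(Complex.exp (I * s) * besselAmp μ s).im‖ ≤ M := by
      refine (Complex.abs_im_le_norm _).trans ?_
      rw [norm_mul, mul_comm I, Complex.norm_exp_ofReal_mul_I, one_mul]
      exact hM s h
    rw [besselIntegral_eq_im_besselAmp hμ (by linarith), Complex.norm_real, norm_mul, norm_mul,
      Real.norm_of_nonneg zero_le_two, Real.norm_of_nonneg (Real.rpow_nonneg hs _)]
    calc 2 * s ^ (-(μ + 1)) * ‖(Complex.exp (I * s) * besselAmp μ s).im‖
        ≤ 2 * ((1 + s) / 2) ^ (-(μ + 1)) * M := by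
          gcongr 2 * ?_ * ?_
          exact Real.rpow_le_rpow_of_nonpos hpos (by linarith) (by linarith)
      _ ≤ (2 + 2 * M) * ((1 + s) / 2) ^ (-(μ + 1)) := by
          nlinarith [Real.rpow_nonneg hpos.le (-(μ + 1))]

end Bessel

section Divergence

lemma not_integrableOn_div_of_le_add_shift {f : ℝ → ℝ} (hf : ∀ s, 0 ≤ f s) {c h : ℝ} (hc : 0 < c)
    (hh : 0 ≤ h) (hfc : ∀ᶠ s in atTop, c ≤ f s + f (s + h)) (R : ℝ) :
    ¬ IntegrableOn (fun s => f s / s) (Ioi R) := by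
  intro hint
  obtain ⟨S, hS⟩ := eventually_atTop.1 (hfc.and
    ((eventually_ge_atTop R).and ((eventually_ge_atTop h).and (eventually_gt_atTop (0 : ℝ)))))
  obtain ⟨-, hSR, hSh, hS0⟩ := hS S le_rfl
  have hint₁ : IntegrableOn (fun s => f s / s) (Ioi S) := hint.mono_set (Ioi_subset_Ioi hSR)
  have hint₂ : IntegrableOn (fun s => f (s + h) / (s + h)) (Ioi S) := by
    have := ((measurePreserving_add_right (volume : Measure ℝ) h).integrableOn_comp_preimage
      (MeasurableEquiv.addRight h).measurableEmbedding).2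
        (hint₁.mono_set (Ioi_subset_Ioi (le_add_of_nonneg_right hh)))
    simpa [Function.comp_def] using this
  have hinv : IntegrableOn (fun s : ℝ => c / 2 * s⁻¹) (Ioi S) := by
    refine (hint₁.add hint₂).mono' (Measurable.aestronglyMeasurable (by fun_prop)) ?_
    filter_upwards [ae_restrict_mem measurableSet_Ioi] with s hs
    have hSs : S < s := hs
    have hs0 : 0 < s := hS0.trans hSs
    rw [Real.norm_of_nonneg (by positivity), Pi.add_apply]
    calc c / 2 * s⁻¹ = c / (2 * s) := by field_simp
      _ ≤ (f s + f (s + h)) / (2 * s) := by gcongr; exact (hS s hSs.le).1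
      _ = f s / (2 * s) + f (s + h) / (2 * s) := add_div _ _ _
      _ ≤ f s / s + f (s + h) / (s + h) := by
        gcongr <;> first | exact hf _ | linarith
  refine not_integrableOn_Ioi_inv (a := S)
    (IntegrableOn.congr_fun (hinv.const_mul (2 / c)) (fun s _ => ?_) measurableSet_Ioi)
  field_simp

/-- Shifting by a quarter period turns the imaginary part of `e^{is} B s` into its real part, so the
two squares add up to `‖B s‖²`. -/
lemma tendsto_sq_im_add_sq_im_shift {B : ℝ → ℂ} {b : ℂ} (hB : Tendsto B atTop (𝓝 b)) :
    Tendsto (fun s : ℝ => (Complex.exp (I * s) * B s).im ^ 2 +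
      (Complex.exp (I * (s + π / 2 : ℝ)) * B (s + π / 2)).im ^ 2) atTop (𝓝 (‖b‖ ^ 2)) := by
  have hunit : ∀ s : ℝ, ‖Complex.exp (I * s)‖ = 1 := fun s => by
    rw [mul_comm, Complex.norm_exp_ofReal_mul_I]
  set e : ℝ → ℝ := fun s => (Complex.exp (I * s) * (B (s + π / 2) - B s)).re
  have he : Tendsto e atTop (𝓝 0) := by
    have hdiff : Tendsto (fun s => ‖B (s + π / 2) - B s‖) atTop (𝓝 0) := by
      simpa using ((hB.comp (tendsto_atTop_add_const_right _ (π / 2) tendsto_id)).sub hB).norm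
    refine squeeze_zero_norm (fun s => (Complex.abs_re_le_norm _).trans_eq ?_) hdiff
    rw [norm_mul, hunit, one_mul]
  have hre : IsBoundedUnder (· ≤ ·) atTop
      (norm ∘ fun s : ℝ => (Complex.exp (I * s) * B s).re) := by
    refine hB.norm.isBoundedUnder_le.mono_le (Eventually.of_forall fun s => ?_)
    refine (Complex.abs_re_le_norm _).trans_eq ?_
    rw [norm_mul, hunit, one_mul]
  have hlim :=
    ((hB.norm.pow 2).add ((he.zero_mul_isBoundedUnder_le hre).const_mul 2)).add (he.pow 2)
  rw [mul_zero, zero_pow two_ne_zero, add_zero, add_zero] at hlim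
  refine hlim.congr fun s => ?_
  have hshift : (Complex.exp (I * (s + π / 2 : ℝ)) * B (s + π / 2)).im =
      (Complex.exp (I * s) * B s).re + e s := by
    have hexp : Complex.exp (I * (s + π / 2 : ℝ)) = I * Complex.exp (I * s) := by
      push_cast
      rw [mul_add, Complex.exp_add, mul_comm I (_ / 2), Complex.exp_pi_div_two_mul_I, mul_comm]
    rw [hexp, mul_assoc, Complex.I_mul_im, ← Complex.add_re, ← mul_add, add_sub_cancel]
  have hnorm : ‖B s‖ ^ 2 =
      (Complex.exp (I * s) * B s).re ^ 2 + (Complex.exp (I * s) * B s).im ^ 2 := by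
    rw [← one_mul ‖B s‖, ← hunit s, ← norm_mul, Complex.sq_norm, Complex.normSq_apply, sq, sq]
  rw [hshift, hnorm]
  ring

lemma not_integrableOn_rpow_mul_norm_besselIntegral_sq {μ : ℝ} (hμ : 0 ≤ μ) (R : ℝ) :
    ¬ IntegrableOn (fun s : ℝ => s ^ (2 * μ + 1) * ‖besselIntegral μ s‖ ^ 2) (Ioi R) := by
  set b : ℂ := (-I) ^ (μ : ℂ) * ((2 ^ μ * Real.Gamma (μ + 1) : ℝ) : ℂ)
  have hb : 0 < ‖b‖ ^ 2 := by
    have hΓ : 0 < 2 ^ μ * Real.Gamma (μ + 1) :=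
      mul_pos (by positivity) (Real.Gamma_pos_of_pos (by linarith))
    rw [norm_mul, norm_neg_I_cpow_ofReal, one_mul, Complex.norm_real]
    exact pow_pos (norm_pos_iff.2 hΓ.ne') 2
  intro hint
  refine not_integrableOn_div_of_le_add_shift
    (f := fun s => (Complex.exp (I * s) * besselAmp μ s).im ^ 2) (fun s => sq_nonneg _)
    (half_pos hb) (h := π / 2) (by positivity)
    ((tendsto_sq_im_add_sq_im_shift (tendsto_besselAmp hμ)).eventually (le_mem_nhds
      (half_lt_self hb))) (max R 0) ?_
  refine IntegrableOn.congr_fun ((hint.mono_set (Ioi_subset_Ioi (le_max_left R 0))).const_mul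
    (1 / 4)) (fun s hs => ?_) measurableSet_Ioi
  have hs : 0 < s := (le_max_right R 0).trans_lt hs
  have hpow : s ^ (2 * μ + 1) * (s ^ (-(μ + 1))) ^ 2 = s⁻¹ := by
    rw [← Real.rpow_natCast, ← Real.rpow_mul hs.le, ← Real.rpow_add hs, ← Real.rpow_neg_one]
    congr 1
    push_cast
    ring
  simp only [besselIntegral_eq_im_besselAmp hμ hs, Complex.norm_real, Real.norm_eq_abs, sq_abs]
  linear_combination (Complex.exp (I * s) * besselAmp μ s).im ^ 2 * hpow

end Divergence

/-! ### Riesz kernels -/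

section Isometry

variable {V W : Type*} [NormedAddCommGroup V] [InnerProductSpace ℝ V] [FiniteDimensional ℝ V]
  [NormedAddCommGroup W] [InnerProductSpace ℝ W] [FiniteDimensional ℝ W]

lemma exists_linearIsometryEquiv_map_eq (hVW : Module.finrank ℝ V = Module.finrank ℝ W) {x : V}
    {y : W} (hxy : ‖x‖ = ‖y‖) : ∃ T : V ≃ₗᵢ[ℝ] W, T x = y := by
  let T₀ : V ≃ₗᵢ[ℝ] W := (stdOrthonormalBasis ℝ V).equiv (stdOrthonormalBasis ℝ W) (finCongr hVW)
  refine ⟨T₀.trans (Submodule.reflection (ℝ ∙ (T₀ x - y))ᗮ), ?_⟩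
  rw [LinearIsometryEquiv.trans_apply]
  exact Submodule.reflection_sub (by rw [LinearIsometryEquiv.norm_map, hxy])

end Isometry

lemma rpow_le_two_rpow_abs_mul_rpow {x y : ℝ} (hx : 0 < x) (hxy : x ≤ y) (hyx : y ≤ 2 * x)
    (ν : ℝ) : x ^ ν ≤ 2 ^ |ν| * y ^ ν := by
  rcases le_total 0 ν with hν | hν
  · rw [abs_of_nonneg hν]
    calc x ^ ν ≤ y ^ ν := by gcongr
      _ ≤ 2 ^ ν * y ^ ν := le_mul_of_one_le_left (Real.rpow_nonneg (hx.le.trans hxy) _)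
          (Real.one_le_rpow one_le_two hν)
  · rw [abs_of_nonpos hν, Real.rpow_neg zero_le_two, ← Real.inv_rpow zero_le_two,
      ← Real.mul_rpow (by norm_num) (hx.le.trans hxy)]
    exact Real.rpow_le_rpow_of_nonpos (by linarith) (by linarith) hν

/-- The kernel `∫ e^{2πi x·ξ} (1 - a|ξ|²)₊^δ dξ` of the linear Bochner-Riesz multiplier. The
parameter `a` is needed because freezing one frequency of the trilinear form of `S^δ` leaves
`1 - |ξ|²` or `1 - 2|ξ|²`, according to which frequency is frozen. -/
def rieszKernel {V : Type*} [NormedAddCommGroup V] [InnerProductSpace ℝ V]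
    [FiniteDimensional ℝ V] [MeasurableSpace V] [BorelSpace V] (a δ : ℝ) (x : V) : ℂ :=
  ∫ ξ : V, Complex.exp (2 * π * I * (inner ℝ x ξ : ℝ)) * (rieszSymbol δ (a * ‖ξ‖ ^ 2) : ℝ)

section RieszKernel

variable {V : Type*} [NormedAddCommGroup V] [InnerProductSpace ℝ V] [FiniteDimensional ℝ V]
  [MeasurableSpace V] [BorelSpace V] {a δ : ℝ}

lemma integrable_norm_pow_mul_rieszSymbol (ha : 0 < a) (hδ : 0 ≤ δ) (k : ℕ) :
    Integrable (fun ξ : V => ‖ξ‖ ^ k * rieszSymbol δ (a * ‖ξ‖ ^ 2)) := by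
  have hball : Integrable
      ((Metric.closedBall (0 : V) (√a)⁻¹).indicator fun _ => ((√a)⁻¹ ^ k : ℝ)) :=
    (integrable_indicator_iff Metric.isClosed_closedBall.measurableSet).2
      (integrableOn_const (isCompact_closedBall _ _).measure_lt_top.ne)
  refine hball.mono' (Measurable.aestronglyMeasurable (by fun_prop))
    (Eventually.of_forall fun ξ => ?_)
  rw [Real.norm_of_nonneg (mul_nonneg (by positivity) (rieszSymbol_nonneg _ _))]
  by_cases hξ : ξ ∈ Metric.closedBall (0 : V) (√a)⁻¹
  · rw [indicator_of_mem hξ, ← mul_one ((√a)⁻¹ ^ k)]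
    gcongr
    · exact rieszSymbol_nonneg _ _
    · exact mem_closedBall_zero_iff.1 hξ
    · exact rieszSymbol_le_one hδ (by positivity)
  · rw [mem_closedBall_zero_iff, not_le, inv_lt_iff_one_lt_mul₀' (by positivity)] at hξ
    have hlt : 1 < a * ‖ξ‖ ^ 2 :=
      calc (1 : ℝ) < (√a * ‖ξ‖) ^ 2 := one_lt_pow₀ hξ two_ne_zero
        _ = a * ‖ξ‖ ^ 2 := by rw [mul_pow, Real.sq_sqrt ha.le]
    rw [rieszSymbol_of_lt hlt, mul_zero]
    exact indicator_nonneg (fun _ _ => by positivity) ξ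

lemma integrable_rieszSymbol (ha : 0 < a) (hδ : 0 ≤ δ) :
    Integrable (fun ξ : V => rieszSymbol δ (a * ‖ξ‖ ^ 2)) := by
  simpa using integrable_norm_pow_mul_rieszSymbol (V := V) ha hδ 0

lemma integral_rieszSymbol_pos (hδ : 0 ≤ δ) : 0 < ∫ u : V, rieszSymbol δ (‖u‖ ^ 2) := by
  rw [integral_pos_iff_support_of_nonneg (fun u => rieszSymbol_nonneg _ _)
    (by simpa using integrable_rieszSymbol (V := V) one_pos hδ)]
  refine (Metric.measure_ball_pos volume (0 : V) one_pos).trans_le (measure_mono fun u hu => ?_)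
  have hlt : ‖u‖ ^ 2 < 1 := pow_lt_one₀ (norm_nonneg u) (mem_ball_zero_iff.1 hu) two_ne_zero
  rw [Function.mem_support, rieszSymbol_of_le hlt.le]
  exact (Real.rpow_pos_of_pos (sub_pos.2 hlt) _).ne'

lemma integral_rieszSymbol_add_norm_sq (δ : ℝ) {s : ℝ} (hs : s ≠ 1) :
    ∫ u : V, rieszSymbol δ (s + ‖u‖ ^ 2) =
      rieszSymbol (δ + Module.finrank ℝ V / 2) s * ∫ u : V, rieszSymbol δ (‖u‖ ^ 2) := by
  rcases hs.lt_or_gt with h | h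
  · have hpos : 0 < 1 - s := by linarith
    have hsqrt : √(1 - s) ^ 2 = 1 - s := Real.sq_sqrt hpos.le
    have hscale : ∀ u : V, rieszSymbol δ (s + ‖√(1 - s) • u‖ ^ 2) =
        (1 - s) ^ δ * rieszSymbol δ (‖u‖ ^ 2) := by
      intro u
      rw [norm_smul, mul_pow, Real.norm_of_nonneg (Real.sqrt_nonneg _), hsqrt]
      rcases le_or_gt (‖u‖ ^ 2) 1 with hu | hu
      · rw [rieszSymbol_of_le hu, rieszSymbol_of_le (by nlinarith),
          ← Real.mul_rpow hpos.le (by linarith)]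
        congr 1
        ring
      · rw [rieszSymbol_of_lt hu, rieszSymbol_of_lt (by nlinarith), mul_zero]
    have hsubst := Measure.integral_comp_smul (volume : Measure V)
      (fun u => rieszSymbol δ (s + ‖u‖ ^ 2)) √(1 - s)
    simp_rw [hscale] at hsubst
    have hpow : (1 - s) ^ ((Module.finrank ℝ V : ℝ) / 2) = √(1 - s) ^ Module.finrank ℝ V := by
      rw [Real.sqrt_eq_rpow, ← Real.rpow_mul_natCast hpos.le, one_div_mul_eq_div]
    rw [abs_of_nonneg (by positivity), smul_eq_mul, integral_const_mul] at hsubst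
    rw [rieszSymbol_of_le h.le, Real.rpow_add hpos, hpow, mul_right_comm, hsubst, mul_comm,
      ← mul_assoc, mul_inv_cancel₀ (by positivity), one_mul]
  · rw [rieszSymbol_of_lt h, zero_mul]
    refine integral_eq_zero_of_ae (Eventually.of_forall fun u => rieszSymbol_of_lt ?_)
    nlinarith [sq_nonneg ‖u‖]

lemma rieszKernel_eq_fourier_neg (a δ : ℝ) (x : V) :
    rieszKernel a δ x = 𝓕 (fun ξ : V => (rieszSymbol δ (a * ‖ξ‖ ^ 2) : ℂ)) (-x) := by
  rw [Real.fourier_eq', rieszKernel]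
  refine integral_congr_ae (Eventually.of_forall fun ξ => ?_)
  simp only [smul_eq_mul]
  congr 2
  rw [inner_neg_right, real_inner_comm]
  push_cast
  ring

lemma contDiff_rieszKernel (ha : 0 < a) (hδ : 0 ≤ δ) :
    ContDiff ℝ (⊤ : ℕ∞) (rieszKernel a δ : V → ℂ) := by
  have hfourier : ContDiff ℝ (⊤ : ℕ∞) (𝓕 (fun ξ : V => (rieszSymbol δ (a * ‖ξ‖ ^ 2) : ℂ))) := by
    refine Real.contDiff_fourier fun k _ => ?_
    simpa only [Complex.norm_real, Real.norm_of_nonneg (rieszSymbol_nonneg _ _)]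
      using integrable_norm_pow_mul_rieszSymbol ha hδ k
  rw [funext (rieszKernel_eq_fourier_neg a δ)]
  exact hfourier.comp contDiff_neg

lemma rieszKernel_eq_smul (ha : 0 < a) (δ : ℝ) (x : V) :
    rieszKernel a δ x =
      (((√a)⁻¹ ^ Module.finrank ℝ V : ℝ) : ℂ) * rieszKernel 1 δ ((√a)⁻¹ • x) := by
  have hsubst := Measure.integral_comp_smul (volume : Measure V)
    (fun ξ => Complex.exp (2 * π * I * (inner ℝ ((√a)⁻¹ • x) ξ : ℝ)) *
      (rieszSymbol δ (1 * ‖ξ‖ ^ 2) : ℝ)) (√a)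
  rw [abs_of_nonneg (by positivity), Complex.real_smul, ← inv_pow] at hsubst
  rw [rieszKernel, rieszKernel, ← hsubst]
  refine integral_congr_ae (Eventually.of_forall fun ξ => ?_)
  have hne : √a ≠ 0 := (Real.sqrt_pos.2 ha).ne'
  simp only [real_inner_smul_left, real_inner_smul_right, norm_smul, mul_pow, one_mul,
    Real.norm_of_nonneg (Real.sqrt_nonneg _), Real.sq_sqrt ha.le]
  rw [mul_inv_cancel_left₀ hne]

section OtherSpace

variable {W : Type*} [NormedAddCommGroup W] [InnerProductSpace ℝ W] [FiniteDimensional ℝ W]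
  [MeasurableSpace W] [BorelSpace W]

lemma rieszKernel_eq_of_norm_eq (hVW : Module.finrank ℝ V = Module.finrank ℝ W) {x : V} {y : W}
    (hxy : ‖x‖ = ‖y‖) (a δ : ℝ) : rieszKernel a δ x = rieszKernel a δ y := by
  obtain ⟨T, rfl⟩ := exists_linearIsometryEquiv_map_eq hVW hxy
  rw [rieszKernel, rieszKernel, ← T.measurePreserving.integral_comp
    T.toMeasurableEquiv.measurableEmbedding]
  simp only [LinearIsometryEquiv.inner_map_map, LinearIsometryEquiv.norm_map]

/-- Fubini along the direction of the argument: the slices of `(1 - |ξ|²)₊^δ` have total mass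
proportional to `(1 - t²)₊^{δ + dim W / 2}`. -/
lemma rieszKernel_toLp_ofReal_zero (hδ : 0 ≤ δ) (s : ℝ) :
    rieszKernel 1 δ (WithLp.toLp 2 (s, (0 : W))) =
      ((∫ u : W, rieszSymbol δ (‖u‖ ^ 2) : ℝ) : ℂ) *
        besselIntegral (δ + Module.finrank ℝ W / 2) (2 * π * s) := by
  have hpres := WithLp.volume_preserving_toLp ℝ W
  have hemb : MeasurableEmbedding (@WithLp.toLp 2 (ℝ × W)) :=
    (MeasurableEquiv.toLp 2 (ℝ × W)).measurableEmbedding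
  have hcoord : rieszKernel 1 δ (WithLp.toLp 2 (s, (0 : W))) = ∫ q : ℝ × W,
      Complex.exp (I * (2 * π * s : ℝ) * q.1) * (rieszSymbol δ (q.1 ^ 2 + ‖q.2‖ ^ 2) : ℝ) := by
    rw [rieszKernel, ← hpres.integral_comp hemb]
    refine integral_congr_ae (Eventually.of_forall fun q => ?_)
    simp only [WithLp.prod_inner_apply, WithLp.prod_norm_sq_eq_of_L2, inner_zero_left,
      add_zero, one_mul, RCLike.inner_apply, conj_trivial, Real.norm_eq_abs, sq_abs]
    congr 2
    push_cast
    ring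
  have hint : Integrable (fun q : ℝ × W => Complex.exp (I * (2 * π * s : ℝ) * q.1) *
      (rieszSymbol δ (q.1 ^ 2 + ‖q.2‖ ^ 2) : ℝ)) (volume.prod volume) := by
    refine Integrable.mono' ((hpres.integrable_comp_emb hemb).2
      (integrable_rieszSymbol (V := WithLp 2 (ℝ × W)) one_pos hδ))
      (Measurable.aestronglyMeasurable (by fun_prop)) (Eventually.of_forall fun q => ?_)
    simp only [Function.comp, WithLp.prod_norm_sq_eq_of_L2, one_mul, Real.norm_eq_abs, sq_abs]
    rw [norm_mul, Complex.norm_real, Real.norm_of_nonneg (rieszSymbol_nonneg _ _), mul_assoc,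
      ← Complex.ofReal_mul, mul_comm I, Complex.norm_exp_ofReal_mul_I, one_mul,
      WithLp.toLp_fst, WithLp.toLp_snd]
  have hne : ∀ᵐ t : ℝ, t ^ 2 ≠ 1 := by
    filter_upwards [((Set.toFinite ({1, -1} : Set ℝ)).countable).ae_notMem volume] with t ht h
    exact ht (by simpa using h)
  rw [hcoord, Measure.volume_eq_prod, integral_prod _ hint, besselIntegral_eq_integral_rieszSymbol,
    ← integral_const_mul]
  refine integral_congr_ae ?_
  filter_upwards [hne] with t ht
  rw [integral_const_mul, integral_complex_ofReal, integral_rieszSymbol_add_norm_sq δ ht]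
  push_cast
  ring

end OtherSpace

lemma exists_rieszKernel_eq_besselIntegral [Nontrivial V] (ha : 0 < a) (hδ : 0 ≤ δ) :
    ∃ c : ℝ, 0 < c ∧ ∀ x : V, rieszKernel a δ x =
      c * besselIntegral (δ + (Module.finrank ℝ V - 1) / 2) (2 * π * (√a)⁻¹ * ‖x‖) := by
  obtain ⟨m, hm⟩ := Nat.exists_eq_succ_of_ne_zero (Module.finrank_pos (R := ℝ) (M := V)).ne'
  let W := EuclideanSpace ℝ (Fin m)
  have hW : Module.finrank ℝ W = m := finrank_euclideanSpace_fin
  have hdim : Module.finrank ℝ V = Module.finrank ℝ (WithLp 2 (ℝ × W)) := by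
    rw [(WithLp.linearEquiv 2 ℝ (ℝ × W)).finrank_eq, Module.finrank_prod, hW, hm,
      Module.finrank_self, add_comm]
  refine ⟨(√a)⁻¹ ^ Module.finrank ℝ V * ∫ u : W, rieszSymbol δ (‖u‖ ^ 2),
    mul_pos (by positivity) (integral_rieszSymbol_pos hδ), fun x => ?_⟩
  have hnorm : ‖(√a)⁻¹ • x‖ = ‖WithLp.toLp 2 ((√a)⁻¹ * ‖x‖, (0 : W))‖ := by
    rw [WithLp.prod_norm_eq_of_L2, norm_smul, Real.norm_of_nonneg (by positivity)]
    have hnonneg : 0 ≤ (√a)⁻¹ * ‖x‖ := by positivity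
    rw [WithLp.toLp_fst, WithLp.toLp_snd, norm_zero, zero_pow two_ne_zero, add_zero,
      Real.sqrt_sq (norm_nonneg _), Real.norm_of_nonneg hnonneg]
  rw [rieszKernel_eq_smul ha, rieszKernel_eq_of_norm_eq hdim hnorm,
    rieszKernel_toLp_ofReal_zero hδ, hW, hm]
  push_cast
  ring_nf

lemma exists_norm_rieszKernel_le [Nontrivial V] (ha : 0 < a) (hδ : 0 ≤ δ) :
    ∃ C : ℝ, 0 < C ∧ ∀ x : V, ‖rieszKernel a δ x‖ ≤
      C * (1 + ‖x‖) ^ (-(δ + (Module.finrank ℝ V + 1) / 2)) := by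
  have hdim : (1 : ℝ) ≤ Module.finrank ℝ V := by
    exact_mod_cast Module.finrank_pos (R := ℝ) (M := V)
  obtain ⟨c, hc, hker⟩ := exists_rieszKernel_eq_besselIntegral (V := V) ha hδ
  obtain ⟨C, hC, hbessel⟩ := exists_norm_besselIntegral_le
    (μ := δ + (Module.finrank ℝ V - 1) / 2) (by linarith)
  set κ := 2 * π * (√a)⁻¹
  have : 0 < κ := by positivity
  set b := δ + ((Module.finrank ℝ V : ℝ) + 1) / 2
  have hb : -(δ + ((Module.finrank ℝ V : ℝ) - 1) / 2 + 1) = -b := by ring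
  refine ⟨c * C * (min 1 κ) ^ (-b), by positivity, fun x => ?_⟩
  have hle : min 1 κ * (1 + ‖x‖) ≤ 1 + κ * ‖x‖ := by
    rw [mul_add, mul_one]
    gcongr
    · exact min_le_left _ _
    · exact min_le_right _ _
  calc ‖rieszKernel a δ x‖ ≤ c * (C * (1 + κ * ‖x‖) ^ (-b)) := by
        rw [hker, norm_mul, Complex.norm_real, Real.norm_of_nonneg hc.le, ← hb]
        gcongr
        exact hbessel _ (by positivity)
    _ ≤ c * (C * (min 1 κ * (1 + ‖x‖)) ^ (-b)) := by
        gcongr c * (C * ?_)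
        exact Real.rpow_le_rpow_of_nonpos (by positivity) hle
          (neg_nonpos.2 (by positivity))
    _ = c * C * (min 1 κ) ^ (-b) * (1 + ‖x‖) ^ (-b) := by
        rw [Real.mul_rpow (by positivity) (by positivity)]
        ring

end RieszKernel

section WeightedDivergence

lemma measurable_besselIntegral (μ : ℝ) : Measurable (besselIntegral μ) := by
  rw [funext (besselIntegral_eq_integral_rieszSymbol μ)]
  refine StronglyMeasurable.measurable ?_
  exact StronglyMeasurable.integral_prod_right (f := fun s t : ℝ =>
    Complex.exp (I * s * t) * (rieszSymbol μ (t ^ 2) : ℝ))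
    (Measurable.stronglyMeasurable (by fun_prop))

lemma not_integrableOn_rpow_mul_norm_besselIntegral_mul_sq {μ κ : ℝ} (hμ : 0 ≤ μ) (hκ : 0 < κ) :
    ¬ IntegrableOn (fun s : ℝ => s ^ (2 * μ + 1) * ‖besselIntegral μ (κ * s)‖ ^ 2) (Ioi 1) := by
  intro hint
  refine not_integrableOn_rpow_mul_norm_besselIntegral_sq hμ (κ * 1) ?_
  refine (integrableOn_Ioi_comp_mul_left_iff
    (fun s : ℝ => s ^ (2 * μ + 1) * ‖besselIntegral μ s‖ ^ 2) 1 hκ).1 ?_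
  refine IntegrableOn.congr_fun (hint.const_mul (κ ^ (2 * μ + 1))) (fun s hs => ?_)
    measurableSet_Ioi
  have hs : 0 ≤ s := zero_le_one.trans (le_of_lt hs)
  simp only [Real.mul_rpow hκ.le hs, mul_assoc]

lemma not_integrableOn_pow_mul_norm_besselIntegral_mul_sq {μ κ ν : ℝ} {d : ℕ} (hμ : 0 ≤ μ)
    (hκ : 0 < κ) (hν : d + 2 * ν = 2 * μ + 1) :
    ¬ IntegrableOn (fun s : ℝ => s ^ d * (‖besselIntegral μ (κ * s)‖ ^ 2 * (1 + s ^ 2) ^ ν))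
      (Ioi 0) := by
  intro hint
  have hmeas := measurable_besselIntegral μ
  refine not_integrableOn_rpow_mul_norm_besselIntegral_mul_sq hμ hκ
    (((hint.mono_set (Ioi_subset_Ioi zero_le_one)).const_mul (2 ^ |ν|)).mono'
      (Measurable.aestronglyMeasurable (by fun_prop)) ?_)
  filter_upwards [ae_restrict_mem measurableSet_Ioi] with s hs
  have hs1 : 1 < s := hs
  have hs0 : 0 < s := by linarith
  have hpow : s ^ (2 * μ + 1) = s ^ d * (s ^ 2) ^ ν := by
    rw [← hν, Real.rpow_add hs0, Real.rpow_natCast, Real.rpow_mul hs0.le, Real.rpow_ofNat]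
  rw [Real.norm_of_nonneg (by positivity), hpow]
  calc s ^ d * (s ^ 2) ^ ν * ‖besselIntegral μ (κ * s)‖ ^ 2
      ≤ s ^ d * (2 ^ |ν| * (1 + s ^ 2) ^ ν) * ‖besselIntegral μ (κ * s)‖ ^ 2 := by
        gcongr
        exact rpow_le_two_rpow_abs_mul_rpow (by positivity) (by linarith) (by nlinarith) ν
    _ = 2 ^ |ν| * (s ^ d * (‖besselIntegral μ (κ * s)‖ ^ 2 * (1 + s ^ 2) ^ ν)) := by ring

/-- The map `L` allows the kernel of a larger space to be restricted to a subspace, such as the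
diagonal. -/
lemma not_integrable_norm_rieszKernel_comp_sq_mul_weight {V W : Type*}
    [NormedAddCommGroup V] [InnerProductSpace ℝ V] [FiniteDimensional ℝ V] [MeasurableSpace V]
    [BorelSpace V] [Nontrivial V] [NormedAddCommGroup W] [InnerProductSpace ℝ W]
    [FiniteDimensional ℝ W] [MeasurableSpace W] [BorelSpace W] [Nontrivial W] {a δ r : ℝ}
    (ha : 0 < a) (hδ : 0 ≤ δ) (hr : 0 < r) {L : V → W} (hL : ∀ x, ‖L x‖ = r * ‖x‖) :
    ¬ Integrable (fun x : V => ‖rieszKernel a δ (L x)‖ ^ 2 *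
      (1 + ‖x‖ ^ 2) ^ (δ + (Module.finrank ℝ W + 1) / 2 - Module.finrank ℝ V / 2 : ℝ)) := by
  have hdimW : (1 : ℝ) ≤ Module.finrank ℝ W := by
    exact_mod_cast Module.finrank_pos (R := ℝ) (M := W)
  obtain ⟨c, hc, hker⟩ := exists_rieszKernel_eq_besselIntegral (V := W) ha hδ
  set μ : ℝ := δ + (Module.finrank ℝ W - 1) / 2
  set ν : ℝ := δ + (Module.finrank ℝ W + 1) / 2 - Module.finrank ℝ V / 2
  have hν : (Module.finrank ℝ V - 1 : ℕ) + 2 * ν = 2 * μ + 1 := by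
    rw [Nat.cast_pred (Module.finrank_pos (R := ℝ) (M := V))]
    ring
  intro hint
  have hradial : Integrable fun x : V =>
      (fun s : ℝ => ‖besselIntegral μ (2 * π * (√a)⁻¹ * r * s)‖ ^ 2 * (1 + s ^ 2) ^ ν) ‖x‖ := by
    refine (hint.const_mul ((c ^ 2)⁻¹)).congr (Eventually.of_forall fun x => ?_)
    simp only [hker, hL, norm_mul, Complex.norm_real, Real.norm_of_nonneg hc.le, mul_pow,
      ← mul_assoc, inv_mul_cancel₀ (pow_pos hc 2).ne', one_mul]
  have hμ : 0 ≤ μ := add_nonneg hδ (by linarith)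
  refine not_integrableOn_pow_mul_norm_besselIntegral_mul_sq hμ
    (κ := 2 * π * (√a)⁻¹ * r) (by positivity) hν ?_
  exact (integrable_fun_norm_addHaar (volume : Measure V) (f := fun s : ℝ =>
    ‖besselIntegral μ (2 * π * (√a)⁻¹ * r * s)‖ ^ 2 * (1 + s ^ 2) ^ ν)).1 hradial

end WeightedDivergence

/-! ### Bilinear convolutions with a dominated kernel -/

section YoungInequality

variable {G : Type*} [AddGroup G] [MeasurableSpace G] [MeasurableAdd₂ G] [MeasurableNeg G]
  {μ : Measure G} [SFinite μ] [μ.IsAddLeftInvariant] {Φ F : G → ℝ≥0∞}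

lemma lintegral_lconvolution (hΦ : AEMeasurable Φ μ) (hF : AEMeasurable F μ) :
    ∫⁻ x, (Φ ⋆ₗ[μ] F) x ∂μ = (∫⁻ x, Φ x ∂μ) * ∫⁻ x, F x ∂μ := by
  have hinner : ∀ y, ∫⁻ x, Φ y * F (-y + x) ∂μ = Φ y * ∫⁻ x, F x ∂μ := fun y => by
    have hFy : AEMeasurable (fun x => F (-y + x)) μ :=
      hF.comp_quasiMeasurePreserving (measurePreserving_add_left μ (-y)).quasiMeasurePreserving
    rw [lintegral_const_mul'' _ hFy, lintegral_add_left_eq_self]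
  simp only [lconvolution_def]
  rw [lintegral_lintegral_swap (by fun_prop)]
  simp_rw [hinner]
  exact lintegral_mul_const'' _ hΦ

lemma lconvolution_rpow_le (hΦ : AEMeasurable Φ μ) (hF : AEMeasurable F μ) {r : ℝ} (hr : 1 ≤ r)
    (x : G) :
    (Φ ⋆ₗ[μ] F) x ^ r ≤ (∫⁻ y, Φ y ∂μ) ^ (r - 1) * (Φ ⋆ₗ[μ] fun y => F y ^ r) x := by
  have hr0 : 0 < r := zero_lt_one.trans_le hr
  have hsplit : ∀ y, Φ y * F (-y + x) = Φ y ^ (1 - r⁻¹) * (Φ y * F (-y + x) ^ r) ^ r⁻¹ := by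
    intro y
    rw [ENNReal.mul_rpow_of_nonneg _ _ (by positivity), ← mul_assoc,
      ← ENNReal.rpow_add_of_nonneg _ _ (sub_nonneg.2 (inv_le_one_of_one_le₀ hr)) (by positivity),
      sub_add_cancel, ENNReal.rpow_one, ENNReal.rpow_rpow_inv hr0.ne']
  calc (Φ ⋆ₗ[μ] F) x ^ r
      = (∫⁻ y, Φ y ^ (1 - r⁻¹) * (Φ y * F (-y + x) ^ r) ^ r⁻¹ ∂μ) ^ r := by
        simp_rw [lconvolution_def, ← hsplit]
    _ ≤ ((∫⁻ y, Φ y ∂μ) ^ (1 - r⁻¹) * (Φ ⋆ₗ[μ] fun y => F y ^ r) x ^ r⁻¹) ^ r := by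
        gcongr
        exact ENNReal.lintegral_mul_norm_pow_le hΦ (by fun_prop)
          (sub_nonneg.2 (inv_le_one_of_one_le₀ hr)) (by positivity) (sub_add_cancel _ _)
    _ = _ := by
        rw [ENNReal.mul_rpow_of_nonneg _ _ hr0.le, ← ENNReal.rpow_mul,
          ENNReal.rpow_inv_rpow hr0.ne', sub_mul, one_mul, inv_mul_cancel₀ hr0.ne']

lemma lconvolution_le_mul_eLpNormEssSup (hΦ : AEMeasurable Φ μ) (x : G) :
    (Φ ⋆ₗ[μ] F) x ≤ (∫⁻ y, Φ y ∂μ) * eLpNormEssSup F μ := by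
  have hbound : ∀ᵐ y ∂μ, F (-y + x) ≤ eLpNormEssSup F μ :=
    ((quasiMeasurePreserving_add_right μ x).comp (quasiMeasurePreserving_neg μ)).ae
      (enorm_ae_le_eLpNormEssSup F μ)
  rw [lconvolution_def, ← lintegral_mul_const'' _ hΦ]
  refine lintegral_mono_ae (hbound.mono fun y hy => ?_)
  gcongr

theorem eLpNorm_lconvolution_le (hΦ : AEMeasurable Φ μ) (hF : AEMeasurable F μ) {p : ℝ≥0∞}
    (hp : 1 ≤ p) : eLpNorm (Φ ⋆ₗ[μ] F) p μ ≤ (∫⁻ x, Φ x ∂μ) * eLpNorm F p μ := by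
  rcases eq_or_ne p ∞ with rfl | hp_top
  · rw [eLpNorm_exponent_top, eLpNorm_exponent_top]
    exact essSup_le_of_ae_le _
      (Eventually.of_forall fun x => lconvolution_le_mul_eLpNormEssSup hΦ x)
  have hp0 : p ≠ 0 := (zero_lt_one.trans_le hp).ne'
  have hr : 1 ≤ p.toReal := by simpa using ENNReal.toReal_mono hp_top hp
  generalize hrp : p.toReal = r at hr
  have hr0 : 0 < r := zero_lt_one.trans_le hr
  set m := ∫⁻ x, Φ x ∂μ
  simp only [eLpNorm_eq_lintegral_rpow_enorm_toReal hp0 hp_top, enorm_eq_self, hrp, one_div]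
  calc (∫⁻ x, (Φ ⋆ₗ[μ] F) x ^ r ∂μ) ^ r⁻¹
      ≤ (∫⁻ x, m ^ (r - 1) * (Φ ⋆ₗ[μ] fun y => F y ^ r) x ∂μ) ^ r⁻¹ := by
        gcongr with x
        exact lconvolution_rpow_le hΦ hF hr x
    _ = (m ^ (r - 1) * (m * ∫⁻ x, F x ^ r ∂μ)) ^ r⁻¹ := by
        rw [lintegral_const_mul'' _ (by fun_prop), lintegral_lconvolution hΦ (by fun_prop)]
    _ = (m ^ r * ∫⁻ x, F x ^ r ∂μ) ^ r⁻¹ := by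
        nth_rewrite 2 [← ENNReal.rpow_one m]
        rw [← mul_assoc, ← ENNReal.rpow_add_of_nonneg _ _ (sub_nonneg.2 hr) zero_le_one,
          sub_add_cancel]
    _ = m * (∫⁻ x, F x ^ r ∂μ) ^ r⁻¹ := by
        rw [ENNReal.mul_rpow_of_nonneg _ _ (by positivity), ENNReal.rpow_rpow_inv hr0.ne']

end YoungInequality

section ENNRealLp

variable {α : Type*} [MeasurableSpace α] {μ : Measure α} {A B : α → ℝ≥0∞} {p p₁ p₂ : ℝ≥0∞}

lemma ae_lt_top_of_eLpNorm_ne_top (hA : AEMeasurable A μ) (hp : p ≠ 0)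
    (hfin : eLpNorm A p μ ≠ ∞) : ∀ᵐ x ∂μ, A x < ∞ := by
  rcases eq_or_ne p ∞ with rfl | hp_top
  · filter_upwards [enorm_ae_le_eLpNormEssSup A μ] with x hx
    exact hx.trans_lt (eLpNorm_exponent_top (f := A) ▸ hfin.lt_top)
  · have hint := lintegral_rpow_enorm_lt_top_of_eLpNorm_lt_top hp hp_top hfin.lt_top
    filter_upwards [ae_lt_top' (hA.pow_const _) hint.ne] with x hx
    exact (ENNReal.rpow_lt_top_iff_of_pos (ENNReal.toReal_pos hp hp_top)).1 hx

lemma eLpNorm_toReal_of_ae_lt_top (hA : ∀ᵐ x ∂μ, A x < ∞) (p : ℝ≥0∞) :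
    eLpNorm (fun x => (A x).toReal) p μ = eLpNorm A p μ := by
  refine eLpNorm_congr_enorm_ae (hA.mono fun x hx => ?_)
  rw [enorm_eq_self, Real.enorm_of_nonneg ENNReal.toReal_nonneg, ENNReal.ofReal_toReal hx.ne]

lemma eLpNorm_le_mul_eLpNorm_of_ae_enorm_le_mul {E : Type*} [NormedAddCommGroup E] {F : α → E}
    [ENNReal.HolderTriple p₁ p₂ p] (hA : AEMeasurable A μ) (hB : AEMeasurable B μ)
    (hA_top : ∀ᵐ x ∂μ, A x < ∞) (hB_top : ∀ᵐ x ∂μ, B x < ∞)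
    (hF : ∀ᵐ x ∂μ, ‖F x‖ₑ ≤ A x * B x) :
    eLpNorm F p μ ≤ eLpNorm A p₁ μ * eLpNorm B p₂ μ := by
  set a : α → ℝ := fun x => (A x).toReal
  set b : α → ℝ := fun x => (B x).toReal
  have hle : eLpNorm F p μ ≤ eLpNorm (a • b) p μ := by
    refine eLpNorm_mono_ae ?_
    filter_upwards [hF, hA_top, hB_top] with x hx hAx hBx
    have hreal := ENNReal.toReal_mono (by finiteness) hx
    rw [toReal_enorm, ENNReal.toReal_mul] at hreal
    exact hreal.trans (le_abs_self _)
  calc eLpNorm F p μ ≤ eLpNorm a p₁ μ * eLpNorm b p₂ μ :=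
        hle.trans (eLpNorm_smul_le_mul_eLpNorm hB.ennreal_toReal.aestronglyMeasurable
          hA.ennreal_toReal.aestronglyMeasurable)
    _ = eLpNorm A p₁ μ * eLpNorm B p₂ μ := by
        rw [eLpNorm_toReal_of_ae_lt_top hA_top, eLpNorm_toReal_of_ae_lt_top hB_top]

end ENNRealLp

section BilinearConvolution

variable {G : Type*} [AddCommGroup G] [MeasurableSpace G] [MeasurableAdd₂ G] [MeasurableNeg G]
  {μ : Measure G} {K : G × G → ℂ} {f g : G → ℂ} {Φ Ψ : G → ℝ≥0∞} {p p₁ p₂ : ℝ≥0∞}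

lemma aestronglyMeasurable_kernel_mul_mul (hK : Measurable K) (hf : AEStronglyMeasurable f μ)
    (hg : AEStronglyMeasurable g μ) :
    AEStronglyMeasurable (fun q : G × (G × G) => K (q.1 - q.2.1, q.1 - q.2.2) * f q.2.1 * g q.2.2)
      (μ.prod (μ.prod μ)) :=
  ((hK.comp (by fun_prop)).aestronglyMeasurable.mul (hf.comp_fst (ν := μ)).comp_snd).mul
    (hg.comp_snd (μ := μ)).comp_snd

variable [SFinite μ] [μ.IsAddLeftInvariant]

lemma ae_lconvolution_enorm_lt_top (hΦ : AEMeasurable Φ μ) (hΦ_int : ∫⁻ x, Φ x ∂μ ≠ ∞)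
    (h₁ : 1 ≤ p₁) (hf : MemLp f p₁ μ) : ∀ᵐ x ∂μ, (Φ ⋆ₗ[μ] fun y => ‖f y‖ₑ) x < ∞ := by
  have hf' := hf.1.enorm
  have hyoung := eLpNorm_lconvolution_le hΦ hf' h₁
  rw [eLpNorm_enorm] at hyoung
  exact ae_lt_top_of_eLpNorm_ne_top (by fun_prop) (zero_lt_one.trans_le h₁).ne'
    (hyoung.trans_lt (ENNReal.mul_lt_top hΦ_int.lt_top hf.2)).ne

variable [μ.IsNegInvariant]

lemma lintegral_enorm_kernel_mul_mul_le (hΦ : Measurable Φ) (hΨ : Measurable Ψ)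
    (hKle : ∀ w, ‖K w‖ₑ ≤ Φ w.1 * Ψ w.2) (hf : AEStronglyMeasurable f μ)
    (hg : AEStronglyMeasurable g μ) (x : G) :
    ∫⁻ w, ‖K (x - w.1, x - w.2) * f w.1 * g w.2‖ₑ ∂μ.prod μ ≤
      (Φ ⋆ₗ[μ] fun y => ‖f y‖ₑ) x * (Ψ ⋆ₗ[μ] fun y => ‖g y‖ₑ) x := by
  have hfΦ : AEMeasurable (fun y => ‖f y‖ₑ * Φ (-y + x)) μ :=
    hf.enorm.mul (hΦ.comp (by fun_prop)).aemeasurable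
  have hgΨ : AEMeasurable (fun y => ‖g y‖ₑ * Ψ (-y + x)) μ :=
    hg.enorm.mul (hΨ.comp (by fun_prop)).aemeasurable
  rw [lconvolution_comm, lconvolution_comm (f := Ψ), lconvolution_def, lconvolution_def,
    ← lintegral_prod_mul hfΦ hgΨ]
  refine lintegral_mono fun w => ?_
  rw [enorm_mul, enorm_mul, neg_add_eq_sub, neg_add_eq_sub]
  calc ‖K (x - w.1, x - w.2)‖ₑ * ‖f w.1‖ₑ * ‖g w.2‖ₑ
      ≤ Φ (x - w.1) * Ψ (x - w.2) * ‖f w.1‖ₑ * ‖g w.2‖ₑ := by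
        gcongr
        exact hKle _
    _ = _ := by ring

lemma ae_integrable_kernel_mul_mul (hK : Measurable K) (hΦ : Measurable Φ) (hΨ : Measurable Ψ)
    (hKle : ∀ w, ‖K w‖ₑ ≤ Φ w.1 * Ψ w.2) (hΦ_int : ∫⁻ x, Φ x ∂μ ≠ ∞)
    (hΨ_int : ∫⁻ x, Ψ x ∂μ ≠ ∞) (h₁ : 1 ≤ p₁) (h₂ : 1 ≤ p₂) (hf : MemLp f p₁ μ)
    (hg : MemLp g p₂ μ) :
    ∀ᵐ x ∂μ, Integrable (fun w => K (x - w.1, x - w.2) * f w.1 * g w.2) (μ.prod μ) := by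
  filter_upwards [ae_lconvolution_enorm_lt_top hΦ.aemeasurable hΦ_int h₁ hf,
    ae_lconvolution_enorm_lt_top hΨ.aemeasurable hΨ_int h₂ hg,
    (aestronglyMeasurable_kernel_mul_mul hK hf.1 hg.1).prodMk_left] with x hfx hgx hmeas
  exact ⟨hmeas, (lintegral_enorm_kernel_mul_mul_le hΦ hΨ hKle hf.1 hg.1 x).trans_lt
    (ENNReal.mul_lt_top hfx hgx)⟩

theorem eLpNorm_integral_kernel_mul_mul_le [ENNReal.HolderTriple p₁ p₂ p] (hΦ : Measurable Φ)
    (hΨ : Measurable Ψ) (hKle : ∀ w, ‖K w‖ₑ ≤ Φ w.1 * Ψ w.2) (hΦ_int : ∫⁻ x, Φ x ∂μ ≠ ∞)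
    (hΨ_int : ∫⁻ x, Ψ x ∂μ ≠ ∞) (h₁ : 1 ≤ p₁) (h₂ : 1 ≤ p₂) (hf : MemLp f p₁ μ)
    (hg : MemLp g p₂ μ) :
    eLpNorm (fun x => ∫ w, K (x - w.1, x - w.2) * f w.1 * g w.2 ∂μ.prod μ) p μ ≤
      (∫⁻ x, Φ x ∂μ) * (∫⁻ x, Ψ x ∂μ) * eLpNorm f p₁ μ * eLpNorm g p₂ μ := by
  have hf' := hf.1.enorm
  have hg' := hg.1.enorm
  calc _ ≤ eLpNorm (Φ ⋆ₗ[μ] fun y => ‖f y‖ₑ) p₁ μ * eLpNorm (Ψ ⋆ₗ[μ] fun y => ‖g y‖ₑ) p₂ μ :=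
        eLpNorm_le_mul_eLpNorm_of_ae_enorm_le_mul (by fun_prop) (by fun_prop)
          (ae_lconvolution_enorm_lt_top hΦ.aemeasurable hΦ_int h₁ hf)
          (ae_lconvolution_enorm_lt_top hΨ.aemeasurable hΨ_int h₂ hg)
          (Eventually.of_forall fun x => (enorm_integral_le_lintegral_enorm _).trans
            (lintegral_enorm_kernel_mul_mul_le hΦ hΨ hKle hf.1 hg.1 x))
    _ ≤ ((∫⁻ x, Φ x ∂μ) * eLpNorm f p₁ μ) * ((∫⁻ x, Ψ x ∂μ) * eLpNorm g p₂ μ) := by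
        rw [← eLpNorm_enorm f, ← eLpNorm_enorm g]
        gcongr
        · exact eLpNorm_lconvolution_le hΦ.aemeasurable hf' h₁
        · exact eLpNorm_lconvolution_le hΨ.aemeasurable hg' h₂
    _ = _ := by ring

end BilinearConvolution

/-! ### The bilinear operator -/

section Operator

variable {n : ℕ} {δ : ℝ}

lemma setIntegral_unitBall_rpow_mul (δ : ℝ) (F : Eucl n × Eucl n → ℂ) :
    ∫ ζ in unitBall n, ((1 - ‖ζ.1‖ ^ 2 - ‖ζ.2‖ ^ 2) ^ δ : ℝ) * F ζ =
      ∫ ζ, (rieszSymbol δ (‖ζ.1‖ ^ 2 + ‖ζ.2‖ ^ 2) : ℝ) * F ζ := by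
  have hmeas : MeasurableSet (unitBall n) := measurableSet_le (by fun_prop) measurable_const
  rw [← integral_indicator hmeas]
  refine integral_congr_ae (Eventually.of_forall fun ζ => ?_)
  by_cases hζ : ζ ∈ unitBall n
  · have hle : ‖ζ.1‖ ^ 2 + ‖ζ.2‖ ^ 2 ≤ 1 := hζ
    simp only [indicator_of_mem hζ, rieszSymbol_of_le hle, sub_sub]
  · have hlt : 1 < ‖ζ.1‖ ^ 2 + ‖ζ.2‖ ^ 2 := not_le.1 hζ
    simp only [indicator_of_notMem hζ, rieszSymbol_of_lt hlt, Complex.ofReal_zero, zero_mul]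

lemma bochnerRiesz_eq_integral_rieszSymbol (δ : ℝ) (f g : Eucl n → ℂ) (x : Eucl n) :
    bochnerRiesz δ f g x = ∫ ζ : Eucl n × Eucl n,
      (rieszSymbol δ (‖ζ.1‖ ^ 2 + ‖ζ.2‖ ^ 2) : ℝ) *
        (Complex.exp (2 * π * I * (inner ℝ x (ζ.1 + ζ.2) : ℝ)) * (𝓕 f ζ.1 * 𝓕 g ζ.2)) := by
  rw [← setIntegral_unitBall_rpow_mul, bochnerRiesz]
  simp only [mul_assoc, mul_left_comm]

lemma kernel_eq_integral_rieszSymbol (δ : ℝ) (w : Eucl n × Eucl n) :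
    kernel δ w = ∫ ζ : Eucl n × Eucl n, (rieszSymbol δ (‖ζ.1‖ ^ 2 + ‖ζ.2‖ ^ 2) : ℝ) *
      Complex.exp (2 * π * I * (inner ℝ w.1 ζ.1 + inner ℝ w.2 ζ.2 : ℝ)) := by
  rw [← setIntegral_unitBall_rpow_mul, kernel]
  simp only [mul_comm]

lemma kernel_eq_rieszKernel (δ : ℝ) (w : Eucl n × Eucl n) :
    kernel δ w = rieszKernel 1 δ (WithLp.toLp 2 w) := by
  rw [kernel_eq_integral_rieszSymbol, rieszKernel,
    ← (WithLp.volume_preserving_toLp (Eucl n) (Eucl n)).integral_comp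
      (MeasurableEquiv.toLp 2 (Eucl n × Eucl n)).measurableEmbedding]
  simp only [WithLp.prod_inner_apply, WithLp.prod_norm_sq_eq_of_L2, WithLp.toLp_fst,
    WithLp.toLp_snd, one_mul, mul_comm]

lemma integrable_rieszSymbol_prod (hδ : 0 ≤ δ) :
    Integrable (fun ζ : Eucl n × Eucl n => rieszSymbol δ (‖ζ.1‖ ^ 2 + ‖ζ.2‖ ^ 2)) := by
  have hint := ((WithLp.volume_preserving_toLp (Eucl n) (Eucl n)).integrable_comp_emb
    (MeasurableEquiv.toLp 2 (Eucl n × Eucl n)).measurableEmbedding).2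
    (integrable_rieszSymbol (V := WithLp 2 (Eucl n × Eucl n)) one_pos hδ)
  simpa only [Function.comp_def, WithLp.prod_norm_sq_eq_of_L2, WithLp.toLp_fst,
    WithLp.toLp_snd, one_mul] using hint

lemma continuous_kernel (hδ : 0 ≤ δ) : Continuous (kernel δ : Eucl n × Eucl n → ℂ) := by
  rw [funext (kernel_eq_rieszKernel δ)]
  exact (contDiff_rieszKernel one_pos hδ).continuous.comp
    (WithLp.prod_continuous_toLp 2 (Eucl n) (Eucl n))

lemma norm_exp_two_pi_I_mul_ofReal (t : ℝ) : ‖Complex.exp (2 * π * I * (t : ℂ))‖ = 1 := by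
  rw [mul_right_comm]
  exact_mod_cast Complex.norm_exp_ofReal_mul_I (2 * π * t)

lemma integral_exp_inner_sub_mul (f g : Eucl n → ℂ) (x : Eucl n) (ζ : Eucl n × Eucl n) :
    ∫ w : Eucl n × Eucl n,
      Complex.exp (2 * π * I * (inner ℝ (x - w.1) ζ.1 + inner ℝ (x - w.2) ζ.2 : ℝ)) *
        (f w.1 * g w.2) =
      Complex.exp (2 * π * I * (inner ℝ x (ζ.1 + ζ.2) : ℝ)) * (𝓕 f ζ.1 * 𝓕 g ζ.2) := by
  rw [Real.fourier_eq', Real.fourier_eq', ← integral_prod_mul, ← Measure.volume_eq_prod,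
    ← integral_const_mul]
  refine integral_congr_ae (Eventually.of_forall fun w => ?_)
  have hexp : Complex.exp (2 * π * I * (inner ℝ (x - w.1) ζ.1 + inner ℝ (x - w.2) ζ.2 : ℝ)) =
      Complex.exp (2 * π * I * (inner ℝ x (ζ.1 + ζ.2) : ℝ)) *
      Complex.exp (((-2 * π * inner ℝ w.1 ζ.1 : ℝ) : ℂ) * I) *
      Complex.exp (((-2 * π * inner ℝ w.2 ζ.2 : ℝ) : ℂ) * I) := by
    rw [← Complex.exp_add, ← Complex.exp_add, inner_sub_left, inner_sub_left, inner_add_right]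
    push_cast
    ring_nf
  simp only [smul_eq_mul, hexp]
  ring

theorem kernelOp_eq_bochnerRiesz (hδ : 0 ≤ δ) {f g : Eucl n → ℂ} (hf : Integrable f)
    (hg : Integrable g) (x : Eucl n) : kernelOp δ f g x = bochnerRiesz δ f g x := by
  set F : Eucl n × Eucl n → Eucl n × Eucl n → ℂ := fun w ζ =>
    (rieszSymbol δ (‖ζ.1‖ ^ 2 + ‖ζ.2‖ ^ 2) : ℝ) *
      (Complex.exp (2 * π * I * (inner ℝ (x - w.1) ζ.1 + inner ℝ (x - w.2) ζ.2 : ℝ)) *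
        (f w.1 * g w.2))
  have hfg : Integrable (fun w : Eucl n × Eucl n => f w.1 * g w.2) := hf.mul_prod hg
  have hint : Integrable (Function.uncurry F) (volume.prod volume) := by
    refine (hfg.norm.mul_prod (integrable_rieszSymbol_prod hδ)).mono' ?_
      (Eventually.of_forall fun q => ?_)
    · exact (Measurable.aestronglyMeasurable (by fun_prop)).mul
        ((Measurable.aestronglyMeasurable (by fun_prop)).mul hfg.1.comp_fst)
    · simp only [Function.uncurry, F]
      rw [norm_mul, norm_mul, norm_exp_two_pi_I_mul_ofReal, Complex.norm_real, one_mul,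
        Real.norm_of_nonneg (rieszSymbol_nonneg _ _), mul_comm]
  calc kernelOp δ f g x = ∫ w, ∫ ζ, F w ζ := by
        refine integral_congr_ae (Eventually.of_forall fun w => ?_)
        simp only [kernelIntegrand, kernel_eq_integral_rieszSymbol, F, mul_assoc]
        simp only [← mul_assoc, integral_mul_const]
    _ = ∫ ζ, ∫ w, F w ζ := integral_integral_swap hint
    _ = bochnerRiesz δ f g x := by
        simp only [F, integral_const_mul, integral_exp_inner_sub_mul,
          bochnerRiesz_eq_integral_rieszSymbol]

lemma finrank_withLp_prod_eucl (n : ℕ) :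
    Module.finrank ℝ (WithLp 2 (Eucl n × Eucl n)) = 2 * n := by
  rw [(WithLp.linearEquiv 2 ℝ (Eucl n × Eucl n)).finrank_eq, Module.finrank_prod,
    finrank_euclideanSpace_fin, two_mul]

lemma one_add_norm_toLp_rpow_le {V W : Type*} [SeminormedAddCommGroup V]
    [SeminormedAddCommGroup W] (w : V × W) {q : ℝ} (hq : 0 ≤ q) :
    (1 + ‖WithLp.toLp 2 w‖) ^ (-(2 * q)) ≤ (1 + ‖w.1‖) ^ (-q) * (1 + ‖w.2‖) ^ (-q) := by
  have hfst : ‖w.1‖ ≤ ‖WithLp.toLp 2 w‖ := WithLp.norm_fst_le _ (WithLp.toLp 2 w)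
  have hsnd : ‖w.2‖ ≤ ‖WithLp.toLp 2 w‖ := WithLp.norm_snd_le _ (WithLp.toLp 2 w)
  rw [two_mul, neg_add, Real.rpow_add (by positivity)]
  gcongr ?_ * ?_ <;> exact Real.rpow_le_rpow_of_nonpos (by positivity) (by linarith) (by linarith)

lemma exists_norm_kernel_le [NeZero n] (hδ : 0 ≤ δ) :
    ∃ C : ℝ, ∀ w : Eucl n × Eucl n, ‖kernel δ w‖ ≤
      C * ((1 + ‖w.1‖) ^ (-((δ + n + 1 / 2) / 2)) * (1 + ‖w.2‖) ^ (-((δ + n + 1 / 2) / 2))) := by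
  have : Nontrivial (WithLp 2 (Eucl n × Eucl n)) := (WithLp.equiv 2 _).nontrivial
  obtain ⟨C, hC, hker⟩ :=
    exists_norm_rieszKernel_le (V := WithLp 2 (Eucl n × Eucl n)) one_pos hδ
  refine ⟨C, fun w => ?_⟩
  have hexp : δ + (Module.finrank ℝ (WithLp 2 (Eucl n × Eucl n)) + 1) / 2 =
      2 * ((δ + n + 1 / 2) / 2) := by
    rw [finrank_withLp_prod_eucl]
    push_cast
    ring
  rw [kernel_eq_rieszKernel]
  refine (hker _).trans ?_
  rw [hexp]
  gcongr
  exact one_add_norm_toLp_rpow_le w (by positivity)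

theorem hasBoundedKernelExtension [NeZero n] (hδ : (n : ℝ) - 1 / 2 < δ) {p₁ p₂ p : ℝ≥0∞}
    (h₁ : 1 ≤ p₁) (h₂ : 1 ≤ p₂) (hp : p⁻¹ = p₁⁻¹ + p₂⁻¹) :
    HasBoundedKernelExtension n δ p₁ p₂ p := by
  have hn : (1 : ℝ) ≤ n := by exact_mod_cast NeZero.one_le
  have hδ0 : 0 ≤ δ := by linarith
  have : ENNReal.HolderTriple p₁ p₂ p := ⟨hp.symm⟩
  obtain ⟨C, hker⟩ := exists_norm_kernel_le (n := n) hδ0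
  set φ : Eucl n → ℝ := fun x => (1 + ‖x‖) ^ (-((δ + n + 1 / 2) / 2))
  have hφ : Integrable φ := integrable_one_add_norm (by
    rw [finrank_euclideanSpace_fin]
    linarith)
  have hφ_top : ∫⁻ x, ‖φ x‖ₑ ≠ ∞ := hφ.2.ne
  have hCφ_top : ∫⁻ x, ‖C * φ x‖ₑ ≠ ∞ := (hφ.const_mul C).2.ne
  have hle : ∀ w : Eucl n × Eucl n, ‖kernel δ w‖ₑ ≤ ‖C * φ w.1‖ₑ * ‖φ w.2‖ₑ := fun w => by
    rw [← enorm_mul]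
    refine enorm_le_iff_norm_le.2 ((hker w).trans ?_)
    rw [← mul_assoc]
    exact le_abs_self _
  have hmeas : Measurable (kernel δ : Eucl n × Eucl n → ℂ) := (continuous_kernel hδ0).measurable
  refine ⟨fun f g hf hg => kernelOp_eq_bochnerRiesz hδ0 hf hg,
    ((∫⁻ x, ‖C * φ x‖ₑ) * ∫⁻ x, ‖φ x‖ₑ).toNNReal, fun f g hf hg => ?_⟩
  have hnorm := eLpNorm_integral_kernel_mul_mul_le (p := p) (by fun_prop) (by fun_prop) hle
    hCφ_top hφ_top h₁ h₂ hf hg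
  rw [← ENNReal.coe_toNNReal (ENNReal.mul_ne_top hCφ_top hφ_top)] at hnorm
  exact ⟨ae_integrable_kernel_mul_mul hmeas (by fun_prop) (by fun_prop) hle hCφ_top hφ_top
      h₁ h₂ hf hg,
    ⟨(aestronglyMeasurable_kernel_mul_mul hmeas hf.1 hg.1).integral_prod_right',
      hnorm.trans_lt (ENNReal.mul_lt_top (ENNReal.mul_lt_top ENNReal.coe_lt_top hf.2) hg.2)⟩,
    hnorm⟩

lemma HasBoundedKernelExtension.isBoundedOnSchwartz {p₁ p₂ p : ℝ≥0∞}
    (h : HasBoundedKernelExtension n δ p₁ p₂ p) : IsBoundedOnSchwartz n δ p₁ p₂ p := by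
  obtain ⟨heq, C, hC⟩ := h
  refine ⟨C, fun f g => ?_⟩
  rw [← funext (heq f g f.integrable g.integrable)]
  exact (hC f g (f.memLp p₁ volume) (g.memLp p₂ volume)).2.2

end Operator

section SchwartzFourier

variable {V : Type*} [NormedAddCommGroup V] [InnerProductSpace ℝ V] [FiniteDimensional ℝ V]
  [MeasurableSpace V] [BorelSpace V]

lemma exists_schwartzMap_fourier_eq {χ : V → ℂ} (hsupp : HasCompactSupport χ)
    (hχ : ContDiff ℝ (⊤ : ℕ∞) χ) : ∃ f : 𝓢(V, ℂ), 𝓕 (f : V → ℂ) = χ := by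
  refine ⟨𝓕⁻ (hsupp.toSchwartzMap hχ), ?_⟩
  rw [← SchwartzMap.fourier_coe, FourierTransform.fourier_fourierInv_eq]
  rfl

variable (V) in
lemma exists_schwartzMap_fourier_eq_one :
    ∃ f : 𝓢(V, ℂ), ∀ ξ : V, ‖ξ‖ ≤ 1 → 𝓕 (f : V → ℂ) ξ = 1 := by
  let φ : ContDiffBump (0 : V) := ⟨1, 2, one_pos, one_lt_two⟩
  obtain ⟨f, hf⟩ := exists_schwartzMap_fourier_eq (χ := fun ξ => (φ ξ : ℂ))
    (φ.hasCompactSupport.comp_left Complex.ofReal_zero)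
    (Complex.ofRealCLM.contDiff.comp φ.contDiff)
  refine ⟨f, fun ξ hξ => ?_⟩
  simp only [hf, φ.one_of_mem_closedBall (mem_closedBall_zero_iff.2 hξ), Complex.ofReal_one]

end SchwartzFourier

section NotMemLp

variable {V W : Type*} [NormedAddCommGroup V] [InnerProductSpace ℝ V] [FiniteDimensional ℝ V]
  [MeasurableSpace V] [BorelSpace V] [Nontrivial V] [NormedAddCommGroup W]
  [InnerProductSpace ℝ W] [FiniteDimensional ℝ W] [MeasurableSpace W] [BorelSpace W]
  {a δ r : ℝ}

lemma one_add_sq_rpow_le {t ν : ℝ} (ht : 0 ≤ t) (hν : 0 ≤ ν) :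
    (1 + t ^ 2) ^ ν ≤ (1 + t) ^ (2 * ν) := by
  rw [Real.rpow_mul (by positivity), Real.rpow_ofNat]
  exact Real.rpow_le_rpow (by positivity) (by nlinarith) hν

lemma sq_mul_weight_le_mul_rpow {y t b C p d : ℝ} (hy : 0 ≤ y) (ht : 0 ≤ t) (hC : 0 ≤ C)
    (hp₀ : 0 ≤ p) (hp₂ : p ≤ 2) (hyC : y ≤ C * (1 + t) ^ (-b)) (hbp : b * p ≤ d)
    (hdb : d / 2 ≤ b) : y ^ 2 * (1 + t ^ 2) ^ (b - d / 2) ≤ C ^ (2 - p) * y ^ p := by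
  have hsplit : y ^ 2 = y ^ p * y ^ (2 - p) := by
    rw [← Real.rpow_add_of_nonneg hy hp₀ (by linarith), add_sub_cancel, Real.rpow_ofNat]
  have hdecay : y ^ (2 - p) ≤ C ^ (2 - p) * (1 + t) ^ (-b * (2 - p)) := by
    rw [Real.rpow_mul (by positivity), ← Real.mul_rpow hC (by positivity)]
    exact Real.rpow_le_rpow hy hyC (by linarith)
  have hcancel : (1 + t) ^ (-b * (2 - p)) * (1 + t) ^ (2 * (b - d / 2)) ≤ 1 := by
    rw [← Real.rpow_add (by positivity)]
    exact Real.rpow_le_one_of_one_le_of_nonpos (by linarith) (by linarith)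
  calc y ^ 2 * (1 + t ^ 2) ^ (b - d / 2)
      ≤ (y ^ p * (C ^ (2 - p) * (1 + t) ^ (-b * (2 - p)))) * (1 + t) ^ (2 * (b - d / 2)) := by
        rw [hsplit]
        gcongr
        exact one_add_sq_rpow_le ht (by linarith)
    _ = C ^ (2 - p) * y ^ p * ((1 + t) ^ (-b * (2 - p)) * (1 + t) ^ (2 * (b - d / 2))) := by ring
    _ ≤ C ^ (2 - p) * y ^ p := mul_le_of_le_one_right (by positivity) hcancel

lemma exists_norm_rieszKernel_comp_le [Nontrivial W] (ha : 0 < a) (hδ : 0 ≤ δ) (hr : 0 < r)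
    {X : Type*} [SeminormedAddCommGroup X] {L : X → W} (hL : ∀ x, ‖L x‖ = r * ‖x‖) :
    ∃ C : ℝ, 0 < C ∧ ∀ x,
      ‖rieszKernel a δ (L x)‖ ≤ C * (1 + ‖x‖) ^ (-(δ + (Module.finrank ℝ W + 1) / 2)) := by
  obtain ⟨C, hC, hker⟩ := exists_norm_rieszKernel_le (V := W) ha hδ
  have hm : 0 < min 1 r := lt_min one_pos hr
  refine ⟨C * min 1 r ^ (-(δ + (Module.finrank ℝ W + 1) / 2) : ℝ), by positivity, fun x => ?_⟩
  refine (hker _).trans ?_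
  rw [mul_assoc, ← Real.mul_rpow hm.le (by positivity), hL]
  have hle : min 1 r * (1 + ‖x‖) ≤ 1 + r * ‖x‖ := by
    rw [mul_add, mul_one]
    gcongr
    exacts [min_le_left _ _, min_le_right _ _]
  refine mul_le_mul_of_nonneg_left (Real.rpow_le_rpow_of_nonpos (by positivity) hle ?_) hC.le
  rw [neg_nonpos]
  positivity

theorem not_memLp_rieszKernel_comp (ha : 0 < a) (hδ : 0 ≤ δ) (hr : 0 < r)
    {L : V →ₗ[ℝ] W} (hL : ∀ x, ‖L x‖ = r * ‖x‖) {p : ℝ≥0∞}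
    (hp : δ + (Module.finrank ℝ W + 1) / 2 ≤ Module.finrank ℝ V * (p⁻¹).toReal) :
    ¬ MemLp (fun x => rieszKernel a δ (L x)) p volume := by
  intro hmem
  have hinj : Function.Injective L := (injective_iff_map_eq_zero L).2 fun x hx => by
    simpa [hx, hr.ne'] using hL x
  have : Nontrivial W := hinj.nontrivial
  have hdim : (Module.finrank ℝ V : ℝ) ≤ Module.finrank ℝ W := by
    exact_mod_cast LinearMap.finrank_le_finrank_of_injective hinj
  set b : ℝ := δ + (Module.finrank ℝ W + 1) / 2
  have hb : 0 < b := by positivity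
  have hdb : (Module.finrank ℝ V : ℝ) / 2 ≤ b := by simp only [b]; linarith
  rw [ENNReal.toReal_inv] at hp
  have hp_pos : 0 < p.toReal :=
    inv_pos.1 (pos_of_mul_pos_right (hb.trans_le hp) (Nat.cast_nonneg _))
  have hbp : b * p.toReal ≤ Module.finrank ℝ V := by
    rwa [← div_eq_mul_inv, le_div_iff₀ hp_pos] at hp
  have hp₂ : p.toReal ≤ 2 := by
    by_contra! h
    nlinarith
  obtain ⟨C, hC, hker⟩ := exists_norm_rieszKernel_comp_le ha hδ hr hL
  obtain ⟨hp₀, hp_top⟩ := ENNReal.toReal_pos_iff.1 hp_pos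
  refine not_integrable_norm_rieszKernel_comp_sq_mul_weight ha hδ hr hL
    (((hmem.integrable_norm_rpow hp₀.ne' hp_top.ne).const_mul (C ^ (2 - p.toReal))).mono' ?_
      (Eventually.of_forall fun x => ?_))
  · exact (hmem.1.norm.pow 2).mul (Measurable.aestronglyMeasurable (by fun_prop))
  · rw [Real.norm_of_nonneg (by positivity)]
    exact sq_mul_weight_le_mul_rpow (norm_nonneg _) (norm_nonneg _) hC.le hp_pos.le hp₂ (hker x)
      hbp hdb

end NotMemLp

section Diagonal

variable {n : ℕ} {δ : ℝ}

lemma bochnerRiesz_eq_kernel_diag (δ : ℝ) {f g : Eucl n → ℂ} (hf : ∀ ξ, ‖ξ‖ ≤ 1 → 𝓕 f ξ = 1)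
    (hg : ∀ ξ, ‖ξ‖ ≤ 1 → 𝓕 g ξ = 1) (x : Eucl n) :
    bochnerRiesz δ f g x = kernel δ (x, x) := by
  rw [bochnerRiesz_eq_integral_rieszSymbol, kernel_eq_integral_rieszSymbol]
  refine integral_congr_ae (Eventually.of_forall fun ζ => ?_)
  simp only [inner_add_right]
  rcases le_or_gt (‖ζ.1‖ ^ 2 + ‖ζ.2‖ ^ 2) 1 with hle | hlt
  · rw [hf, hg, mul_one, mul_one] <;>
      nlinarith [norm_nonneg ζ.1, norm_nonneg ζ.2, sq_nonneg ‖ζ.1‖, sq_nonneg ‖ζ.2‖]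
  · simp only [rieszSymbol_of_lt hlt, Complex.ofReal_zero, zero_mul]

lemma norm_toLp_diag {V : Type*} [SeminormedAddCommGroup V] (x : V) :
    ‖WithLp.toLp 2 (x, x)‖ = √2 * ‖x‖ := by
  rw [WithLp.prod_norm_eq_of_L2, WithLp.toLp_fst, WithLp.toLp_snd, ← two_mul,
    Real.sqrt_mul zero_le_two, Real.sqrt_sq (norm_nonneg x)]

lemma not_memLp_kernel_diag [NeZero n] (hδ : 0 ≤ δ) {p : ℝ≥0∞}
    (hp : δ ≤ n * ((p⁻¹).toReal - 1) - 1 / 2) :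
    ¬ MemLp (fun x : Eucl n => kernel δ (x, x)) p volume := by
  simp only [kernel_eq_rieszKernel]
  refine not_memLp_rieszKernel_comp one_pos hδ (r := √2) (by positivity)
    (L := (WithLp.linearEquiv 2 ℝ (Eucl n × Eucl n)).symm.toLinearMap ∘ₗ
      LinearMap.prod LinearMap.id LinearMap.id) norm_toLp_diag ?_
  rw [finrank_withLp_prod_eucl, finrank_euclideanSpace_fin]
  push_cast
  linarith

theorem not_isBoundedOnSchwartz_of_le [NeZero n] (hδ : 0 ≤ δ) {p : ℝ≥0∞} (p₁ p₂ : ℝ≥0∞)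
    (hp : δ ≤ n * ((p⁻¹).toReal - 1) - 1 / 2) : ¬ IsBoundedOnSchwartz n δ p₁ p₂ p := by
  rintro ⟨C, hC⟩
  obtain ⟨f, hf⟩ := exists_schwartzMap_fourier_eq_one (Eucl n)
  have hbound := hC f f
  rw [funext (bochnerRiesz_eq_kernel_diag δ hf hf)] at hbound
  refine not_memLp_kernel_diag hδ hp ⟨?_, hbound.trans_lt ?_⟩
  · exact ((continuous_kernel hδ).comp (by fun_prop)).aestronglyMeasurable
  · exact ENNReal.mul_lt_top (ENNReal.mul_lt_top ENNReal.coe_lt_top (f.memLp p₁ volume).2)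
      (f.memLp p₂ volume).2

end Diagonal

section Duality

/-- The power `‖z‖ ^ p`, regularized at the origin by `ε > 0` so that it is smooth. -/
def regularizedPow (p ε : ℝ) (z : ℂ) : ℝ := ‖z‖ ^ 2 * (‖z‖ ^ 2 + ε) ^ ((p - 2) / 2)

/-- The smooth substitute for `conj z * ‖z‖ ^ (p - 2)`, the function dual to `z` in Hölder's
inequality with exponents `p` and its conjugate: its product with `z` is `regularizedPow p ε z`. -/
def regularizedDual (p ε : ℝ) (z : ℂ) : ℂ := conj z * ((‖z‖ ^ 2 + ε) ^ ((p - 2) / 2) : ℝ)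

variable {p q ε : ℝ}

lemma regularizedPow_nonneg (hε : 0 ≤ ε) (z : ℂ) : 0 ≤ regularizedPow p ε z := by
  unfold regularizedPow
  positivity

lemma mul_regularizedDual (p ε : ℝ) (z : ℂ) :
    z * regularizedDual p ε z = regularizedPow p ε z := by
  rw [regularizedDual, regularizedPow, ← mul_assoc, Complex.mul_conj, Complex.normSq_eq_norm_sq]
  push_cast
  rfl

lemma norm_regularizedDual (hε : 0 ≤ ε) (z : ℂ) :
    ‖regularizedDual p ε z‖ = ‖z‖ * (‖z‖ ^ 2 + ε) ^ ((p - 2) / 2) := by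
  rw [regularizedDual, norm_mul, RCLike.norm_conj, Complex.norm_real,
    Real.norm_of_nonneg (by positivity)]

lemma norm_le_rpow_half_sq_add (hε : 0 ≤ ε) (z : ℂ) : ‖z‖ ≤ (‖z‖ ^ 2 + ε) ^ (1 / 2 : ℝ) := by
  rw [← Real.sqrt_eq_rpow]
  exact Real.le_sqrt_of_sq_le (le_add_of_nonneg_right hε)

lemma norm_regularizedDual_one_le_one (hε : 0 < ε) (z : ℂ) : ‖regularizedDual 1 ε z‖ ≤ 1 := by
  have hpos : 0 < ‖z‖ ^ 2 + ε := by positivity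
  calc ‖regularizedDual 1 ε z‖ = ‖z‖ * (‖z‖ ^ 2 + ε) ^ (-(1 / 2) : ℝ) := by
        rw [norm_regularizedDual hε.le]
        norm_num
    _ ≤ (‖z‖ ^ 2 + ε) ^ (1 / 2 : ℝ) * (‖z‖ ^ 2 + ε) ^ (-(1 / 2) : ℝ) := by
        gcongr
        exact norm_le_rpow_half_sq_add hε.le z
    _ = 1 := by rw [← Real.rpow_add hpos, add_neg_cancel, Real.rpow_zero]

lemma norm_regularizedDual_rpow_le (hε : 0 < ε) (hpq : p.HolderConjugate q) (hq : 2 ≤ q)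
    (z : ℂ) : ‖regularizedDual p ε z‖ ^ q ≤ regularizedPow p ε z := by
  have hpos : 0 < ‖z‖ ^ 2 + ε := by positivity
  have hexp : (p - 2) / 2 * q = (p - 2) / 2 - 1 / 2 * (q - 2) := by
    linear_combination hpq.mul_eq_add / 2
  have hsplit : ‖z‖ ^ q = ‖z‖ ^ 2 * ‖z‖ ^ (q - 2) := by
    rw [← Real.rpow_ofNat, ← Real.rpow_add_of_nonneg (norm_nonneg z) zero_le_two (by linarith),
      add_sub_cancel]
  have hle : ‖z‖ ^ (q - 2) ≤ (‖z‖ ^ 2 + ε) ^ (1 / 2 * (q - 2)) := by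
    rw [Real.rpow_mul hpos.le]
    exact Real.rpow_le_rpow (norm_nonneg z) (norm_le_rpow_half_sq_add hε.le z) (by linarith)
  calc ‖regularizedDual p ε z‖ ^ q
      = ‖z‖ ^ 2 * ‖z‖ ^ (q - 2) *
          ((‖z‖ ^ 2 + ε) ^ ((p - 2) / 2) / (‖z‖ ^ 2 + ε) ^ (1 / 2 * (q - 2))) := by
        rw [norm_regularizedDual hε.le, Real.mul_rpow (norm_nonneg z) (by positivity),
          ← Real.rpow_mul hpos.le, hexp, Real.rpow_sub hpos, hsplit]
    _ ≤ ‖z‖ ^ 2 * (‖z‖ ^ 2 + ε) ^ (1 / 2 * (q - 2)) *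
          ((‖z‖ ^ 2 + ε) ^ ((p - 2) / 2) / (‖z‖ ^ 2 + ε) ^ (1 / 2 * (q - 2))) := by gcongr
    _ = regularizedPow p ε z := by
        rw [mul_assoc, mul_div_cancel₀ _ (Real.rpow_pos_of_pos hpos _).ne', regularizedPow]

lemma tendsto_regularizedPow (hp : p ≠ 0) (z : ℂ) :
    Tendsto (fun ε => regularizedPow p ε z) (𝓝 0) (𝓝 (‖z‖ ^ p)) := by
  rcases eq_or_ne z 0 with rfl | hz
  · simp [regularizedPow, Real.zero_rpow hp]
  · have hlim : Tendsto (fun ε : ℝ => ‖z‖ ^ 2 + ε) (𝓝 0) (𝓝 (‖z‖ ^ 2)) := by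
      simpa using tendsto_const_nhds.add (tendsto_id (x := 𝓝 (0 : ℝ)))
    have hpow : ‖z‖ ^ p = ‖z‖ ^ 2 * (‖z‖ ^ 2) ^ ((p - 2) / 2) := by
      rw [← Real.rpow_natCast_mul (norm_nonneg z), ← Real.rpow_natCast,
        ← Real.rpow_add (norm_pos_iff.2 hz)]
      push_cast
      ring_nf
    rw [hpow]
    exact (hlim.rpow_const (Or.inl (by positivity))).const_mul _

lemma contDiff_regularizedDual (hε : 0 < ε) :
    ContDiff ℝ (⊤ : ℕ∞) (regularizedDual p ε) := by
  refine Complex.conjCLE.contDiff.mul (Complex.ofRealCLM.contDiff.comp ?_)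
  exact ((contDiff_norm_sq ℝ).add contDiff_const).rpow_const_of_ne fun z => by positivity

lemma continuous_regularizedPow (hε : 0 < ε) : Continuous (regularizedPow p ε) :=
  (by fun_prop : Continuous fun z : ℂ => ‖z‖ ^ 2).mul
    ((by fun_prop : Continuous fun z : ℂ => ‖z‖ ^ 2 + ε).rpow_const fun z => Or.inl (by positivity))

lemma integrable_of_tendsto_of_integral_le {α : Type*} [MeasurableSpace α] {μ : Measure α}
    {G : ℕ → α → ℝ} {f : α → ℝ} {B : ℝ} (hG : ∀ k, Integrable (G k) μ)
    (hG₀ : ∀ k x, 0 ≤ G k x) (hB : ∀ k, ∫ x, G k x ∂μ ≤ B)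
    (hlim : ∀ x, Tendsto (fun k => G k x) atTop (𝓝 (f x))) : Integrable f μ := by
  rw [← memLp_one_iff_integrable]
  refine ⟨aestronglyMeasurable_of_tendsto_ae atTop (fun k => (hG k).1)
    (Eventually.of_forall hlim), ?_⟩
  refine (Lp.eLpNorm_lim_le_liminf_eLpNorm (fun k => (hG k).1) f
    (Eventually.of_forall hlim)).trans_lt (lt_of_le_of_lt ?_ (ENNReal.ofReal_lt_top (r := B)))
  refine liminf_le_of_le (by isBoundedDefault) fun b hb => ?_
  obtain ⟨k, hk⟩ := hb.exists
  refine hk.trans ?_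
  rw [eLpNorm_one_eq_lintegral_enorm, ← ofReal_integral_norm_eq_lintegral_enorm (hG k)]
  refine ENNReal.ofReal_le_ofReal (le_of_eq_of_le ?_ (hB k))
  exact integral_congr_ae (Eventually.of_forall fun x => Real.norm_of_nonneg (hG₀ k x))

lemma norm_regularizedDual_mul_rpow_le (hε : 0 < ε) (hpq : p.HolderConjugate q) (hq : 2 ≤ q)
    (z : ℂ) {t : ℝ} (ht₀ : 0 ≤ t) (ht₁ : t ≤ 1) :
    ‖regularizedDual p ε z * t‖ ^ q ≤ regularizedPow p ε z * t := by
  have ht : t ^ q ≤ t := by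
    simpa using Real.rpow_le_rpow_of_exponent_ge_of_imp ht₀ ht₁ hpq.symm.lt.le
      fun _ h => absurd h hpq.symm.ne_zero
  rw [norm_mul, Complex.norm_real, Real.norm_of_nonneg ht₀, Real.mul_rpow (norm_nonneg _) ht₀]
  exact mul_le_mul (norm_regularizedDual_rpow_le hε hpq hq _) ht
    (Real.rpow_nonneg ht₀ _) (regularizedPow_nonneg hε.le _)

lemma eLpNorm_le_sqrt_max_one_integral {α : Type*} [MeasurableSpace α] {μ : Measure α}
    {f : α → ℂ} {G : α → ℝ} {q : ℝ≥0∞} (hq : 2 ≤ q) (hq_top : q ≠ ∞) (hG : Integrable G μ)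
    (hf : ∀ x, ‖f x‖ ^ q.toReal ≤ G x) :
    eLpNorm f q μ ≤ ENNReal.ofReal √(max 1 (∫ x, G x ∂μ)) := by
  have hq₂ : 2 ≤ q.toReal := by simpa using ENNReal.toReal_mono hq_top hq
  rw [eLpNorm_eq_lintegral_rpow_enorm_toReal (two_pos.trans_le hq).ne' hq_top]
  calc (∫⁻ x, ‖f x‖ₑ ^ q.toReal ∂μ) ^ (1 / q.toReal)
      ≤ ENNReal.ofReal (∫ x, G x ∂μ) ^ (1 / q.toReal) := by
        gcongr
        rw [ofReal_integral_eq_lintegral_ofReal hG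
          (Eventually.of_forall fun x => (Real.rpow_nonneg (norm_nonneg _) _).trans (hf x))]
        refine lintegral_mono fun x => ?_
        rw [← ofReal_norm, ENNReal.ofReal_rpow_of_nonneg (norm_nonneg _) (by positivity)]
        exact ENNReal.ofReal_le_ofReal (hf x)
    _ ≤ ENNReal.ofReal (max 1 (∫ x, G x ∂μ)) ^ (1 / 2 : ℝ) := by
        refine (ENNReal.rpow_le_rpow (ENNReal.ofReal_le_ofReal (le_max_right 1 _))
          (by positivity)).trans ?_
        refine ENNReal.rpow_le_rpow_of_exponent_le ?_ (by gcongr)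
        exact ENNReal.one_le_ofReal.2 (le_max_left 1 _)
    _ = ENNReal.ofReal √(max 1 (∫ x, G x ∂μ)) := by
        rw [ENNReal.ofReal_rpow_of_nonneg (by positivity) (by norm_num), Real.sqrt_eq_rpow]

lemma ne_top_of_holderConjugate_of_two_le {p q : ℝ≥0∞} [p.HolderConjugate q] (hq : 2 ≤ q) :
    p ≠ ∞ := by
  rintro rfl
  have hq_one : q = 1 := ENNReal.HolderConjugate.unique ∞ q 1
  exact absurd hq (by simp [hq_one])

lemma eLpNorm_regularizedDual_mul_le {α : Type*} [MeasurableSpace α] {μ : Measure α} {K : α → ℂ}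
    {χ : α → ℝ} {p q : ℝ≥0∞} [p.HolderConjugate q] (hq : 2 ≤ q) (hε : 0 < ε)
    (hχ₀ : ∀ x, 0 ≤ χ x) (hχ₁ : ∀ x, χ x ≤ 1)
    (hint : Integrable (fun x => regularizedPow p.toReal ε (K x) * χ x) μ) :
    eLpNorm (fun x => regularizedDual p.toReal ε (K x) * χ x) q μ ≤
      ENNReal.ofReal √(max 1 (∫ x, regularizedPow p.toReal ε (K x) * χ x ∂μ)) := by
  rcases eq_or_ne q ∞ with rfl | hq_top
  · have hp : p = 1 := ENNReal.HolderConjugate.unique ∞ p 1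
    refine eLpNormEssSup_le_of_ae_bound (Eventually.of_forall fun x => ?_)
    calc ‖regularizedDual p.toReal ε (K x) * χ x‖ ≤ 1 * 1 := by
          rw [norm_mul, Complex.norm_real, Real.norm_of_nonneg (hχ₀ x), hp, ENNReal.toReal_one]
          exact mul_le_mul (norm_regularizedDual_one_le_one hε _) (hχ₁ x) (hχ₀ x) zero_le_one
      _ ≤ √(max 1 (∫ x, regularizedPow p.toReal ε (K x) * χ x ∂μ)) := by
          rw [one_mul]
          exact Real.one_le_sqrt.2 (le_max_left _ _)
  · have hpq := ENNReal.HolderConjugate.toReal_of_ne_top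
      (ne_top_of_holderConjugate_of_two_le hq : p ≠ ∞) hq_top
    have hq₂ : 2 ≤ q.toReal := by simpa using ENNReal.toReal_mono hq_top hq
    exact eLpNorm_le_sqrt_max_one_integral hq hq_top hint fun x =>
      norm_regularizedDual_mul_rpow_le hε hpq hq₂ (K x) (hχ₀ x) (hχ₁ x)

lemma le_one_add_sq_of_le_mul_sqrt_max {A M : ℝ} (h : A ≤ M * √(max 1 A)) :
    A ≤ 1 + M ^ 2 := by
  rcases le_total A 1 with hA | hA
  · nlinarith [sq_nonneg M]
  · rw [max_eq_right hA] at h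
    have : 1 ≤ √A := Real.one_le_sqrt.2 hA
    nlinarith [Real.mul_self_sqrt (zero_le_one.trans hA)]

variable {V : Type*} [NormedAddCommGroup V] [InnerProductSpace ℝ V] [FiniteDimensional ℝ V]
  [MeasurableSpace V] [BorelSpace V]

lemma integral_regularizedPow_mul_le {K : V → ℂ} (hK : ContDiff ℝ (⊤ : ℕ∞) K) {p q : ℝ≥0∞}
    [p.HolderConjugate q] (hq : 2 ≤ q) {M : ℝ≥0}
    (hM : ∀ g : 𝓢(V, ℂ), ‖∫ x, K x * g x‖ₑ ≤ M * eLpNorm g q volume) (hε : 0 < ε)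
    (φ : ContDiffBump (0 : V)) :
    Integrable (fun x => regularizedPow p.toReal ε (K x) * φ x) ∧
      ∫ x, regularizedPow p.toReal ε (K x) * φ x ≤ 1 + M ^ 2 := by
  have hint : Integrable (fun x => regularizedPow p.toReal ε (K x) * φ x) :=
    (((continuous_regularizedPow hε).comp hK.continuous).mul
      φ.continuous).integrable_of_hasCompactSupport φ.hasCompactSupport.mul_left
  set A := ∫ x, regularizedPow p.toReal ε (K x) * φ x
  have hA : 0 ≤ A := integral_nonneg fun x =>
    mul_nonneg (regularizedPow_nonneg hε.le _) φ.nonneg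
  have hsupp : HasCompactSupport fun x => regularizedDual p.toReal ε (K x) * φ x :=
    (φ.hasCompactSupport.comp_left Complex.ofReal_zero).mul_left
  have hsmooth : ContDiff ℝ (⊤ : ℕ∞) fun x => regularizedDual p.toReal ε (K x) * φ x :=
    ((contDiff_regularizedDual hε).comp hK).mul (Complex.ofRealCLM.contDiff.comp φ.contDiff)
  have hpair : ∫ x, K x * hsupp.toSchwartzMap hsmooth x = A := by
    rw [← integral_complex_ofReal]
    refine integral_congr_ae (Eventually.of_forall fun x => ?_)
    change K x * (regularizedDual p.toReal ε (K x) * φ x) =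
      ((regularizedPow p.toReal ε (K x) * φ x : ℝ) : ℂ)
    rw [← mul_assoc, mul_regularizedDual, Complex.ofReal_mul]
  have hbound : ENNReal.ofReal A ≤ ENNReal.ofReal (M * √(max 1 A)) := by
    calc ENNReal.ofReal A = ‖∫ x, K x * hsupp.toSchwartzMap hsmooth x‖ₑ := by
          rw [hpair, ← ofReal_norm, Complex.norm_real, Real.norm_of_nonneg hA]
      _ ≤ M * ENNReal.ofReal √(max 1 A) := (hM _).trans (by
          gcongr
          exact eLpNorm_regularizedDual_mul_le hq hε (fun _ => φ.nonneg) (fun _ => φ.le_one) hint)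
      _ = ENNReal.ofReal (M * √(max 1 A)) := by
          rw [ENNReal.ofReal_mul M.coe_nonneg, ENNReal.ofReal_coe_nnreal]
  refine ⟨hint, le_one_add_sq_of_le_mul_sqrt_max (M := M) ?_⟩
  exact (ENNReal.ofReal_le_ofReal_iff (by positivity)).1 hbound

/-- Test against the regularized dual function of `K`, cut off: since `2 ≤ q`, its `L^q` norm is
controlled by its pairing with `K`. -/
theorem memLp_of_enorm_integral_mul_le {K : V → ℂ} (hK : ContDiff ℝ (⊤ : ℕ∞) K) {p q : ℝ≥0∞}
    [p.HolderConjugate q] (hq : 2 ≤ q) {M : ℝ≥0}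
    (hM : ∀ g : 𝓢(V, ℂ), ‖∫ x, K x * g x‖ₑ ≤ M * eLpNorm g q volume) : MemLp K p volume := by
  have hp_top : p ≠ ∞ := ne_top_of_holderConjugate_of_two_le hq
  have hp₀ : p ≠ 0 := ENNReal.HolderConjugate.ne_zero p q
  let φ : ℕ → ContDiffBump (0 : V) := fun k => ⟨k + 1, k + 2, by positivity, by linarith⟩
  have hmain := fun k : ℕ => integral_regularizedPow_mul_le (p := p) (ε := 1 / ((k : ℝ) + 1))
    hK hq hM (by positivity) (φ k)
  rw [← integrable_norm_rpow_iff hK.continuous.aestronglyMeasurable hp₀ hp_top]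
  refine integrable_of_tendsto_of_integral_le (fun k => (hmain k).1)
    (fun k x => mul_nonneg (regularizedPow_nonneg (by positivity) _) (φ k).nonneg)
    (fun k => (hmain k).2) fun x => ?_
  refine ((tendsto_regularizedPow (ENNReal.toReal_pos hp₀ hp_top).ne' (K x)).comp
    tendsto_one_div_add_atTop_nhds_zero_nat).congr' ?_
  filter_upwards [eventually_ge_atTop ⌈‖x‖⌉₊] with k hk
  have hx : x ∈ Metric.closedBall (0 : V) (φ k).rIn := by
    rw [mem_closedBall_zero_iff]
    exact (Nat.ceil_le.1 hk).trans (le_add_of_nonneg_right zero_le_one)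
  rw [Function.comp_apply, (φ k).one_of_mem_closedBall hx, mul_one]

end Duality

/-! ### Restriction of the trilinear form to a zero frequency -/

section SchwartzFourierBounds

variable {V : Type*} [NormedAddCommGroup V] [InnerProductSpace ℝ V] [FiniteDimensional ℝ V]
  [MeasurableSpace V] [BorelSpace V]

lemma integrable_fourier_schwartzMap (f : 𝓢(V, ℂ)) : Integrable (𝓕 (f : V → ℂ)) := by
  rw [← SchwartzMap.fourier_coe]
  exact (𝓕 f).integrable

lemma continuous_fourier_schwartzMap (f : 𝓢(V, ℂ)) : Continuous (𝓕 (f : V → ℂ)) := by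
  rw [← SchwartzMap.fourier_coe]
  exact (𝓕 f).continuous

lemma exists_norm_fourier_schwartzMap_le (f : 𝓢(V, ℂ)) :
    ∃ B : ℝ, ∀ ξ, ‖𝓕 (f : V → ℂ) ξ‖ ≤ B := by
  obtain ⟨B, -, hB⟩ := (𝓕 f).decay 0 0
  refine ⟨B, fun ξ => ?_⟩
  rw [← SchwartzMap.fourier_coe]
  simpa using hB ξ

lemma fourier_neg_eq_integral (f : V → ℂ) (ξ : V) :
    𝓕 f (-ξ) = ∫ x, Complex.exp (2 * π * I * (inner ℝ x ξ : ℝ)) * f x := by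
  rw [Real.fourier_eq']
  refine integral_congr_ae (Eventually.of_forall fun x => ?_)
  simp only [smul_eq_mul, inner_neg_right]
  push_cast
  ring_nf

lemma eLpNorm_top_le_lintegral_fourier (g : 𝓢(V, ℂ)) :
    eLpNorm g ∞ volume ≤ ∫⁻ ξ, ‖𝓕 (g : V → ℂ) ξ‖ₑ := by
  rw [eLpNorm_exponent_top]
  refine essSup_le_of_ae_le _ (Eventually.of_forall fun x => ?_)
  have hinv : g x = 𝓕⁻ (𝓕 (g : V → ℂ)) x := by
    rw [← SchwartzMap.fourier_coe, ← SchwartzMap.fourierInv_coe,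
      FourierTransform.fourierInv_fourier_eq]
  simp only [hinv, Real.fourierInv_eq']
  refine (enorm_integral_le_lintegral_enorm _).trans (lintegral_mono fun ξ => ?_)
  rw [enorm_smul, ← ofReal_norm, Complex.norm_exp_ofReal_mul_I, ENNReal.ofReal_one, one_mul]

lemma exists_schwartzMap_fourier_eq_normed (φ : ContDiffBump (0 : V)) :
    ∃ g : 𝓢(V, ℂ), (∀ ξ, 𝓕 (g : V → ℂ) ξ = (φ.normed volume ξ : ℂ)) ∧
      eLpNorm g ∞ volume ≤ 1 := by
  obtain ⟨g, hg⟩ := exists_schwartzMap_fourier_eq (χ := fun ξ => (φ.normed volume ξ : ℂ))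
    (φ.hasCompactSupport_normed.comp_left Complex.ofReal_zero)
    (Complex.ofRealCLM.contDiff.comp φ.contDiff_normed)
  have henorm : ∀ ξ, ‖(φ.normed volume ξ : ℂ)‖ₑ = ENNReal.ofReal (φ.normed volume ξ) := fun ξ => by
    rw [← ofReal_norm, Complex.norm_real, Real.norm_of_nonneg (φ.nonneg_normed ξ)]
  refine ⟨g, fun ξ => by rw [hg], (eLpNorm_top_le_lintegral_fourier g).trans_eq ?_⟩
  simp_rw [hg, henorm]
  rw [← ofReal_integral_eq_lintegral_ofReal φ.integrable_normed
    (Eventually.of_forall φ.nonneg_normed), φ.integral_normed, ENNReal.ofReal_one]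

end SchwartzFourierBounds

section Slice

variable {V : Type*} [NormedAddCommGroup V] [InnerProductSpace ℝ V] [FiniteDimensional ℝ V]
  [MeasurableSpace V] [BorelSpace V]

lemma enorm_le_of_forall_bump {Ψ : V → ℂ} (hΨ_meas : AEStronglyMeasurable Ψ volume)
    (hΨ : ContinuousAt Ψ 0) {M : ℝ≥0∞}
    (hM : ∀ φ : ContDiffBump (0 : V), ‖∫ η, (φ.normed volume η : ℂ) * Ψ η‖ₑ ≤ M) :
    ‖Ψ 0‖ₑ ≤ M := by
  let φ : ℕ → ContDiffBump (0 : V) := fun k =>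
    ⟨1 / (2 * ((k : ℝ) + 1)), 1 / ((k : ℝ) + 1), by positivity, by gcongr; linarith⟩
  have hneg : Tendsto (fun η : V => Ψ (-η)) (𝓝 0) (𝓝 (Ψ 0)) :=
    hΨ.tendsto.comp (by simpa using (continuous_neg (G := V)).tendsto 0)
  have hlim := ContDiffBump.convolution_tendsto_right (μ := (volume : Measure V))
    (φ := φ) (g := fun _ η => Ψ (-η)) (k := fun _ => 0) (x₀ := 0) (z₀ := Ψ 0) (l := atTop)
    tendsto_one_div_add_atTop_nhds_zero_nat
    (Eventually.of_forall fun _ => hΨ_meas.comp_quasiMeasurePreserving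
      (Measure.measurePreserving_neg volume).quasiMeasurePreserving)
    (hneg.comp tendsto_snd) tendsto_const_nhds
  refine le_of_tendsto' hlim.enorm fun k => ?_
  simpa [convolution_def] using hM (φ k)

lemma enorm_integral_slice_le_of_forall_bump {F : V × V → ℂ} (hF : Measurable F) {u : V → ℝ}
    (hu : Integrable u) (hFu : ∀ q, ‖F q‖ ≤ u q.1)
    (hcont : ∀ᵐ ξ, ContinuousAt (fun η => F (ξ, η)) 0) {M : ℝ≥0∞}
    (hM : ∀ φ : ContDiffBump (0 : V), ‖∫ q : V × V, (φ.normed volume q.2 : ℂ) * F q‖ₑ ≤ M) :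
    ‖∫ ξ, F (ξ, 0)‖ₑ ≤ M := by
  refine enorm_le_of_forall_bump (Ψ := fun η => ∫ ξ, F (ξ, η)) ?_ ?_ fun φ => ?_
  · exact (hF.comp measurable_swap).aestronglyMeasurable.integral_prod_right'
  · exact continuousAt_of_dominated
      (Eventually.of_forall fun η => (hF.comp measurable_prodMk_right).aestronglyMeasurable)
      (Eventually.of_forall fun η => Eventually.of_forall fun ξ => hFu (ξ, η)) hu hcont
  · have hint : Integrable (fun q : V × V => (φ.normed volume q.2 : ℂ) * F q) := by
      refine (hu.mul_prod (φ.integrable_normed (μ := volume))).mono' ?_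
        (Eventually.of_forall fun q => ?_)
      · have hφ : Measurable (φ.normed (volume : Measure V)) := φ.continuous_normed.measurable
        exact Measurable.aestronglyMeasurable (by fun_prop)
      · rw [norm_mul, Complex.norm_real, Real.norm_of_nonneg (φ.nonneg_normed _), mul_comm]
        exact mul_le_mul_of_nonneg_right (hFu q) (φ.nonneg_normed _)
    simp_rw [← integral_const_mul]
    rw [← integral_prod_symm _ hint]
    exact hM φ

lemma integral_comp_neg_add (F : V × V → ℂ) :
    ∫ q : V × V, F (q.1, -(q.1 + q.2)) = ∫ q, F q := by
  have hpres : MeasurePreserving (fun q : V × V => (q.1, -(q.1 + q.2))) :=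
    ((MeasurePreserving.id volume).prod (Measure.measurePreserving_neg volume)).comp
      (measurePreserving_prod_add volume volume)
  have hinv : Function.Involutive fun q : V × V => (q.1, -(q.1 + q.2)) := fun q => by simp
  exact hpres.integral_comp
    (MeasurableEquiv.ofInvolutive _ hinv hpres.measurable).measurableEmbedding F

end Slice

/-- The bilinear form `∫ (1 - a|ξ|²)₊^δ f̂(ξ) ĝ(-ξ) dξ` of a linear Bochner-Riesz multiplier. The
duality pairing is not conjugated, whence the argument `-ξ`. -/
def rieszForm {V : Type*} [NormedAddCommGroup V] [InnerProductSpace ℝ V] [FiniteDimensional ℝ V]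
    [MeasurableSpace V] [BorelSpace V] (a δ : ℝ) (f g : V → ℂ) : ℂ :=
  ∫ ξ, (rieszSymbol δ (a * ‖ξ‖ ^ 2) : ℂ) * (𝓕 f ξ * 𝓕 g (-ξ))

section RieszForm

variable {V : Type*} [NormedAddCommGroup V] [InnerProductSpace ℝ V] [FiniteDimensional ℝ V]
  [MeasurableSpace V] [BorelSpace V] {a δ : ℝ} {p q : ℝ≥0∞}

lemma rieszForm_symm (a δ : ℝ) (f g : V → ℂ) : rieszForm a δ f g = rieszForm a δ g f := by
  rw [rieszForm, ← integral_neg_eq_self, rieszForm]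
  simp only [norm_neg, neg_neg, mul_comm]

lemma ae_mul_norm_sq_ne_one [Nontrivial V] (ha : 0 < a) : ∀ᵐ ξ : V, a * ‖ξ‖ ^ 2 ≠ 1 := by
  have hsphere : ∀ᵐ ξ : V, ξ ∉ Metric.sphere (0 : V) (√a)⁻¹ :=
    measure_eq_zero_iff_ae_notMem.1 (Measure.addHaar_sphere volume _ _)
  filter_upwards [hsphere] with ξ hξ hone
  refine hξ (mem_sphere_zero_iff_norm.2 (eq_inv_of_mul_eq_one_right ?_))
  rw [← pow_eq_one_iff_of_nonneg (by positivity) two_ne_zero, mul_pow, Real.sq_sqrt ha.le, hone]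

lemma enorm_rieszForm_le_of_forall_bump [Nontrivial V] (ha : 0 < a) (hδ : 0 ≤ δ)
    {s : V × V → ℝ} (hs : Continuous s) (hs₀ : ∀ q, 0 ≤ s q) (hsa : ∀ ξ, s (ξ, 0) = a * ‖ξ‖ ^ 2)
    (f h : 𝓢(V, ℂ)) {M : ℝ≥0∞}
    (hM : ∀ φ : ContDiffBump (0 : V), ‖∫ q : V × V, (φ.normed volume q.2 : ℂ) *
      ((rieszSymbol δ (s q) : ℂ) * (𝓕 (f : V → ℂ) q.1 * 𝓕 (h : V → ℂ) (-(q.1 + q.2))))‖ₑ ≤ M) :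
    ‖rieszForm a δ f h‖ₑ ≤ M := by
  have hf := (continuous_fourier_schwartzMap f).measurable
  have hh := continuous_fourier_schwartzMap h
  obtain ⟨B, hB⟩ := exists_norm_fourier_schwartzMap_le h
  have hslice : rieszForm a δ f h = ∫ ξ, (rieszSymbol δ (s (ξ, 0)) : ℂ) *
      (𝓕 (f : V → ℂ) ξ * 𝓕 (h : V → ℂ) (-(ξ + 0))) := by simp only [rieszForm, hsa, add_zero]
  rw [hslice]
  refine enorm_integral_slice_le_of_forall_bump (F := fun q : V × V => (rieszSymbol δ (s q) : ℂ) *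
    (𝓕 (f : V → ℂ) q.1 * 𝓕 (h : V → ℂ) (-(q.1 + q.2))))
    (by have := hs.measurable; have := hh.measurable; fun_prop)
    ((integrable_fourier_schwartzMap f).norm.mul_const B) (fun q => ?_) ?_ hM
  · rw [norm_mul, norm_mul, Complex.norm_real, Real.norm_of_nonneg (rieszSymbol_nonneg _ _)]
    exact (mul_le_of_le_one_left (by positivity) (rieszSymbol_le_one hδ (hs₀ q))).trans
      (by gcongr; exact hB _)
  · filter_upwards [ae_mul_norm_sq_ne_one ha] with ξ hξ
    have hsymbol : ContinuousAt (fun η => rieszSymbol δ (s (ξ, η))) 0 :=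
      ContinuousAt.comp (f := fun η => s (ξ, η)) (continuousAt_rieszSymbol (by rwa [hsa]))
        (hs.comp (by fun_prop)).continuousAt
    have hfourier : Continuous fun η => 𝓕 (f : V → ℂ) ξ * 𝓕 (h : V → ℂ) (-(ξ + η)) :=
      continuous_const.mul (hh.comp (by fun_prop))
    exact (Complex.continuous_ofReal.continuousAt.comp hsymbol).mul hfourier.continuousAt

lemma rieszForm_eq_integral_rieszKernel_mul (ha : 1 ≤ a) (hδ : 0 ≤ δ) {f : V → ℂ}
    (hf : ∀ ξ, ‖ξ‖ ≤ 1 → 𝓕 f ξ = 1) (g : 𝓢(V, ℂ)) :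
    rieszForm a δ f g = ∫ x, rieszKernel a δ x * g x := by
  have hint : Integrable (Function.uncurry fun x ξ : V =>
      Complex.exp (2 * π * I * (inner ℝ x ξ : ℝ)) * (rieszSymbol δ (a * ‖ξ‖ ^ 2) : ℝ) * g x)
      (volume.prod volume) := by
    have hg := g.continuous.measurable
    refine (g.integrable.norm.mul_prod (integrable_rieszSymbol (V := V)
      (one_pos.trans_le ha) hδ)).mono' (Measurable.aestronglyMeasurable
        (by unfold Function.uncurry; fun_prop)) (Eventually.of_forall fun q => ?_)
    rw [Function.uncurry, norm_mul, norm_mul, norm_exp_two_pi_I_mul_ofReal, one_mul,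
      Complex.norm_real, Real.norm_of_nonneg (rieszSymbol_nonneg _ _), mul_comm]
  have hfourier : ∀ ξ, (rieszSymbol δ (a * ‖ξ‖ ^ 2) : ℂ) * (𝓕 f ξ * 𝓕 (g : V → ℂ) (-ξ)) =
      (rieszSymbol δ (a * ‖ξ‖ ^ 2) : ℂ) * 𝓕 (g : V → ℂ) (-ξ) := fun ξ => by
    rcases le_or_gt ‖ξ‖ 1 with h | h
    · rw [hf ξ h, one_mul]
    · rw [rieszSymbol_of_lt (by nlinarith), Complex.ofReal_zero, zero_mul, zero_mul]
  simp_rw [rieszForm, hfourier, fourier_neg_eq_integral, rieszKernel, ← integral_mul_const,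
    ← integral_const_mul]
  rw [integral_integral_swap hint]
  simp only [mul_assoc, mul_left_comm]

lemma toReal_inv_add_toReal_inv (p q : ℝ≥0∞) [p.HolderConjugate q] :
    (p⁻¹).toReal + (q⁻¹).toReal = 1 := by
  rw [← ENNReal.toReal_add (ENNReal.inv_ne_top.2 (ENNReal.HolderConjugate.ne_zero p q))
    (ENNReal.inv_ne_top.2 (ENNReal.HolderConjugate.ne_zero q p)),
    ENNReal.HolderConjugate.inv_add_inv_eq_one p q, ENNReal.toReal_one]

lemma two_le_of_half_le_toReal_inv [p.HolderConjugate q] (hp : 1 / 2 ≤ (p⁻¹).toReal) : 2 ≤ q := by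
  have hq : (q⁻¹).toReal ≤ (2⁻¹ : ℝ≥0∞).toReal := by
    rw [ENNReal.toReal_inv 2, ENNReal.toReal_ofNat]
    linarith [toReal_inv_add_toReal_inv p q]
  rwa [ENNReal.toReal_le_toReal (ENNReal.inv_ne_top.2 (ENNReal.HolderConjugate.ne_zero q p))
    (by simp), ENNReal.inv_le_inv] at hq

lemma not_forall_enorm_rieszForm_le [Nontrivial V] (ha : 1 ≤ a) (hδ : 0 ≤ δ) [p.HolderConjugate q]
    (hp : δ ≤ Module.finrank ℝ V * ((p⁻¹).toReal - 1 / 2) - 1 / 2) {f : V → ℂ}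
    (hf : ∀ ξ, ‖ξ‖ ≤ 1 → 𝓕 f ξ = 1) (M : ℝ≥0) :
    ¬ ∀ g : 𝓢(V, ℂ), ‖rieszForm a δ f g‖ₑ ≤ M * eLpNorm g q volume := fun hM => by
  have ha₀ : 0 < a := one_pos.trans_le ha
  have hp₂ : 1 / 2 ≤ (p⁻¹).toReal := by
    by_contra! hlt
    have : 0 ≤ Module.finrank ℝ V * (1 / 2 - (p⁻¹).toReal) :=
      mul_nonneg (Nat.cast_nonneg _) (by linarith)
    linarith
  refine not_memLp_rieszKernel_comp ha₀ hδ one_pos (L := (LinearMap.id : V →ₗ[ℝ] V)) (p := p)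
    (fun x => by simp) (by linarith) ?_
  refine memLp_of_enorm_integral_mul_le (p := p) (contDiff_rieszKernel ha₀ hδ)
    (two_le_of_half_le_toReal_inv hp₂ : 2 ≤ q) (M := M) fun g => ?_
  rw [← rieszForm_eq_integral_rieszKernel_mul ha hδ hf]
  exact hM g

theorem not_exists_rieszForm_bound [Nontrivial V] (ha : 1 ≤ a) (hδ : 0 ≤ δ) [p.HolderConjugate q]
    (hp : δ ≤ Module.finrank ℝ V * |(p⁻¹).toReal - 1 / 2| - 1 / 2) :
    ¬ ∃ C : ℝ≥0, ∀ f g : 𝓢(V, ℂ),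
      ‖rieszForm a δ f g‖ₑ ≤ C * eLpNorm f p volume * eLpNorm g q volume := by
  rintro ⟨C, hC⟩
  obtain ⟨f, hf⟩ := exists_schwartzMap_fourier_eq_one V
  rcases abs_choice ((p⁻¹).toReal - 1 / 2) with h | h <;> rw [h] at hp
  · refine not_forall_enorm_rieszForm_le (q := q) ha hδ hp hf (C * (eLpNorm f p volume).toNNReal)
      fun g => ?_
    rw [ENNReal.coe_mul, ENNReal.coe_toNNReal (f.memLp p volume).2.ne]
    exact hC f g
  · have hq : -((p⁻¹).toReal - 1 / 2) = (q⁻¹).toReal - 1 / 2 := by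
      linarith [toReal_inv_add_toReal_inv p q]
    refine not_forall_enorm_rieszForm_le (p := q) (q := p) ha hδ (hq ▸ hp) hf
      (C * (eLpNorm f q volume).toNNReal) fun g => ?_
    rw [rieszForm_symm, ENNReal.coe_mul, ENNReal.coe_toNNReal (f.memLp q volume).2.ne,
      mul_right_comm]
    exact hC g f

end RieszForm

section Trilinear

variable {n : ℕ} {δ : ℝ} {p q : ℝ≥0∞}

lemma integrable_trilinear_integrand (hδ : 0 ≤ δ) (f g h : 𝓢(Eucl n, ℂ)) :
    Integrable (Function.uncurry fun (x : Eucl n) (ζ : Eucl n × Eucl n) =>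
      (rieszSymbol δ (‖ζ.1‖ ^ 2 + ‖ζ.2‖ ^ 2) : ℝ) *
        (Complex.exp (2 * π * I * (inner ℝ x (ζ.1 + ζ.2) : ℝ)) *
          (𝓕 (f : Eucl n → ℂ) ζ.1 * 𝓕 (g : Eucl n → ℂ) ζ.2)) * h x)
      (volume.prod volume) := by
  have hf := (continuous_fourier_schwartzMap f).measurable
  have hg := (continuous_fourier_schwartzMap g).measurable
  have hh := h.continuous.measurable
  refine (h.integrable.norm.mul_prod ((integrable_fourier_schwartzMap f).mul_prod
    (integrable_fourier_schwartzMap g)).norm).mono' (Measurable.aestronglyMeasurable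
      (by unfold Function.uncurry; fun_prop)) (Eventually.of_forall fun q => ?_)
  rw [Function.uncurry, norm_mul, norm_mul, norm_mul, norm_exp_two_pi_I_mul_ofReal, one_mul,
    mul_comm, Complex.norm_real, Real.norm_of_nonneg (rieszSymbol_nonneg _ _)]
  gcongr
  exact mul_le_of_le_one_left (norm_nonneg _) (rieszSymbol_le_one hδ (by positivity))

lemma integral_bochnerRiesz_mul (hδ : 0 ≤ δ) (f g h : 𝓢(Eucl n, ℂ)) :
    ∫ x, bochnerRiesz δ f g x * h x = ∫ ζ : Eucl n × Eucl n,
      (rieszSymbol δ (‖ζ.1‖ ^ 2 + ‖ζ.2‖ ^ 2) : ℝ) * (𝓕 (f : Eucl n → ℂ) ζ.1 *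
        𝓕 (g : Eucl n → ℂ) ζ.2 * 𝓕 (h : Eucl n → ℂ) (-(ζ.1 + ζ.2))) := by
  simp_rw [bochnerRiesz_eq_integral_rieszSymbol, ← integral_mul_const]
  rw [integral_integral_swap (integrable_trilinear_integrand hδ f g h)]
  simp_rw [fourier_neg_eq_integral, ← integral_const_mul]
  refine integral_congr_ae (Eventually.of_forall fun ζ =>
    integral_congr_ae (Eventually.of_forall fun x => ?_))
  ring

lemma aestronglyMeasurable_bochnerRiesz (δ : ℝ) (f g : 𝓢(Eucl n, ℂ)) :
    AEStronglyMeasurable (bochnerRiesz δ f g) volume := by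
  have hf := (continuous_fourier_schwartzMap f).measurable
  have hg := (continuous_fourier_schwartzMap g).measurable
  have hmeas : AEStronglyMeasurable (fun q : Eucl n × (Eucl n × Eucl n) =>
      (rieszSymbol δ (‖q.2.1‖ ^ 2 + ‖q.2.2‖ ^ 2) : ℝ) *
        (Complex.exp (2 * π * I * (inner ℝ q.1 (q.2.1 + q.2.2) : ℝ)) *
          (𝓕 (f : Eucl n → ℂ) q.2.1 * 𝓕 (g : Eucl n → ℂ) q.2.2))) (volume.prod volume) :=
    Measurable.aestronglyMeasurable (by fun_prop)
  rw [funext (bochnerRiesz_eq_integral_rieszSymbol δ f g)]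
  exact hmeas.integral_prod_right'

lemma enorm_integral_bochnerRiesz_mul_le (δ : ℝ) (f g h : 𝓢(Eucl n, ℂ)) [p.HolderConjugate q] :
    ‖∫ x, bochnerRiesz δ f g x * h x‖ₑ ≤
      eLpNorm (bochnerRiesz δ f g) p volume * eLpNorm h q volume := by
  refine (enorm_integral_le_lintegral_enorm _).trans ?_
  rw [← eLpNorm_one_eq_lintegral_enorm]
  exact eLpNorm_smul_le_mul_eLpNorm (φ := bochnerRiesz δ f g) (f := h)
    h.continuous.aestronglyMeasurable (aestronglyMeasurable_bochnerRiesz δ f g)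

lemma bochnerRiesz_symm (δ : ℝ) (f g : Eucl n → ℂ) : bochnerRiesz δ f g = bochnerRiesz δ g f := by
  funext x
  rw [bochnerRiesz_eq_integral_rieszSymbol, bochnerRiesz_eq_integral_rieszSymbol,
    Measure.volume_eq_prod, ← integral_prod_swap]
  simp only [Prod.fst_swap, Prod.snd_swap, add_comm, mul_comm]

lemma IsBoundedOnSchwartz.symm {p₁ p₂ : ℝ≥0∞} (h : IsBoundedOnSchwartz n δ p₁ p₂ p) :
    IsBoundedOnSchwartz n δ p₂ p₁ p := by
  obtain ⟨C, hC⟩ := h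
  refine ⟨C, fun f g => ?_⟩
  rw [bochnerRiesz_symm, mul_right_comm]
  exact hC g f

lemma IsBoundedOnSchwartz.exists_rieszForm_one_bound [NeZero n] (hδ : 0 ≤ δ) [p.HolderConjugate q]
    (hb : IsBoundedOnSchwartz n δ p ∞ p) :
    ∃ C : ℝ≥0, ∀ f h : 𝓢(Eucl n, ℂ),
      ‖rieszForm 1 δ f h‖ₑ ≤ C * eLpNorm f p volume * eLpNorm h q volume := by
  obtain ⟨C, hC⟩ := hb
  refine ⟨C, fun f h => enorm_rieszForm_le_of_forall_bump one_pos hδ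
    (s := fun q => ‖q.1‖ ^ 2 + ‖q.2‖ ^ 2) (by fun_prop) (fun q => by positivity)
    (fun ξ => by simp) f h fun φ => ?_⟩
  obtain ⟨g, hg, hg_norm⟩ := exists_schwartzMap_fourier_eq_normed φ
  calc _ = ‖∫ x, bochnerRiesz δ f g x * h x‖ₑ := by
        rw [integral_bochnerRiesz_mul hδ]
        simp only [hg, mul_assoc, mul_left_comm]
    _ ≤ eLpNorm (bochnerRiesz δ f g) p volume * eLpNorm h q volume :=
        enorm_integral_bochnerRiesz_mul_le δ f g h
    _ ≤ C * eLpNorm f p volume * 1 * eLpNorm h q volume := by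
        gcongr
        exact (hC f g).trans (by gcongr)
    _ = C * eLpNorm f p volume * eLpNorm h q volume := by rw [mul_one]

lemma IsBoundedOnSchwartz.exists_rieszForm_two_bound [NeZero n] (hδ : 0 ≤ δ)
    (hb : IsBoundedOnSchwartz n δ p q 1) :
    ∃ C : ℝ≥0, ∀ f g : 𝓢(Eucl n, ℂ),
      ‖rieszForm 2 δ f g‖ₑ ≤ C * eLpNorm f p volume * eLpNorm g q volume := by
  obtain ⟨C, hC⟩ := hb
  refine ⟨C, fun f g => enorm_rieszForm_le_of_forall_bump two_pos hδ
    (s := fun q => ‖q.1‖ ^ 2 + ‖-(q.1 + q.2)‖ ^ 2) (by fun_prop) (fun q => by positivity)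
    (fun ξ => by simp [two_mul]) f g fun φ => ?_⟩
  obtain ⟨h, hh, hh_norm⟩ := exists_schwartzMap_fourier_eq_normed φ
  calc _ = ‖∫ x, bochnerRiesz δ f g x * h x‖ₑ := by
        rw [integral_bochnerRiesz_mul hδ, ← integral_comp_neg_add]
        have hη : ∀ q : Eucl n × Eucl n, -(q.1 + -(q.1 + q.2)) = q.2 := fun q => by abel
        simp only [hη, hh]
        congr 2 with q
        ring
    _ ≤ eLpNorm (bochnerRiesz δ f g) 1 volume * eLpNorm h ∞ volume :=
        enorm_integral_bochnerRiesz_mul_le δ f g h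
    _ ≤ C * eLpNorm f p volume * eLpNorm g q volume * 1 := by
        gcongr
        exact hC f g
    _ = C * eLpNorm f p volume * eLpNorm g q volume := mul_one _

end Trilinear

section Exponents

variable {p : ℝ≥0∞}

lemma ne_zero_of_inv_eq_add_inv {p₁ p₂ : ℝ≥0∞} (h₁ : 1 ≤ p₁) (h₂ : 1 ≤ p₂)
    (hp : p⁻¹ = p₁⁻¹ + p₂⁻¹) : p ≠ 0 := by
  rw [← ENNReal.inv_ne_top, hp]
  exact ENNReal.add_ne_top.2 ⟨ENNReal.inv_ne_top.2 (one_pos.trans_le h₁).ne',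
    ENNReal.inv_ne_top.2 (one_pos.trans_le h₂).ne'⟩

lemma le_mul_toReal_inv_sub_one_iff (n : ℕ) {δ : ℝ} (hδ : 0 ≤ δ) (hp : p ≠ 0) :
    δ ≤ n * ((p⁻¹).toReal - 1) - 1 / 2 ↔
      p ≤ ENNReal.ofReal (2 * n / (2 * n + 2 * δ + 1)) := by
  have : (0 : ℝ) ≤ n := n.cast_nonneg
  rcases eq_or_ne p ∞ with rfl | hp_top
  · simp only [ENNReal.inv_top, ENNReal.toReal_zero, top_le_iff, ENNReal.ofReal_ne_top,
      iff_false, not_le]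
    linarith
  · have hr : 0 < p.toReal := ENNReal.toReal_pos hp hp_top
    have hfrac : n * (p.toReal⁻¹ - 1) - 1 / 2 = (n - n * p.toReal - p.toReal / 2) / p.toReal := by
      field_simp
    rw [ENNReal.le_ofReal_iff_toReal_le hp_top (by positivity), le_div_iff₀ (by positivity),
      ENNReal.toReal_inv, hfrac, le_div_iff₀ hr]
    constructor <;> intro h <;> linarith

end Exponents

end BilinearBochnerRiesz

end

theorem mainTheorem8 (n : ℕ) (hn : 1 ≤ n) (δ : ℝ) (hδ : 0 ≤ δ) :
    (∀ p₁ p₂ p : ℝ≥0∞, 1 ≤ p₁ → 1 ≤ p₂ → p⁻¹ = p₁⁻¹ + p₂⁻¹ →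
      ((n : ℝ) - 1 / 2 < δ →
        BilinearBochnerRiesz.IsBoundedOnSchwartz n δ p₁ p₂ p ∧
        BilinearBochnerRiesz.HasBoundedKernelExtension n δ p₁ p₂ p) ∧
      (δ ≤ n * ((p⁻¹).toReal - 1) - 1 / 2 ↔
        p ≤ ENNReal.ofReal (2 * n / (2 * n + 2 * δ + 1))) ∧
      (p ≤ ENNReal.ofReal (2 * n / (2 * n + 2 * δ + 1)) →
        ¬ BilinearBochnerRiesz.IsBoundedOnSchwartz n δ p₁ p₂ p)) ∧
    (∀ p p' : ℝ≥0∞, 1 ≤ p → p⁻¹ + p'⁻¹ = 1 →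
      δ ≤ n * |(p⁻¹).toReal - 1 / 2| - 1 / 2 →
        ¬ BilinearBochnerRiesz.IsBoundedOnSchwartz n δ p ∞ p ∧
        ¬ BilinearBochnerRiesz.IsBoundedOnSchwartz n δ ∞ p p ∧
        ¬ BilinearBochnerRiesz.IsBoundedOnSchwartz n δ p p' 1) := by
  have : NeZero n := ⟨Nat.one_le_iff_ne_zero.1 hn⟩
  refine ⟨fun p₁ p₂ p h₁ h₂ hp => ?_, fun p p' _ hpp' hδp => ?_⟩
  · have hiff := BilinearBochnerRiesz.le_mul_toReal_inv_sub_one_iff n hδ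
      (BilinearBochnerRiesz.ne_zero_of_inv_eq_add_inv h₁ h₂ hp)
    refine ⟨fun h => ?_, hiff, fun h =>
      BilinearBochnerRiesz.not_isBoundedOnSchwartz_of_le hδ p₁ p₂ (hiff.2 h)⟩
    have hK := BilinearBochnerRiesz.hasBoundedKernelExtension h h₁ h₂ hp
    exact ⟨hK.isBoundedOnSchwartz, hK⟩
  · have : p.HolderConjugate p' := ⟨by rw [hpp', inv_one]⟩
    rw [← finrank_euclideanSpace_fin (𝕜 := ℝ) (n := n)] at hδp
    have hone := BilinearBochnerRiesz.not_exists_rieszForm_bound (q := p') le_rfl hδ hδp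
    have htwo := BilinearBochnerRiesz.not_exists_rieszForm_bound (q := p') one_le_two hδ hδp
    exact ⟨fun h => hone (h.exists_rieszForm_one_bound hδ),
      fun h => hone (h.symm.exists_rieszForm_one_bound hδ),
      fun h => htwo (h.exists_rieszForm_two_bound hδ)⟩
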